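/- **Setting.** A *system* is a nondeterministic finite automaton $\mathcal A=(Q,\Sigma,\delta,I,S)$ with nonempty alphabet $\Sigma=\Sigma_p\uplus\Sigma_{up}$ (protectable and unprotectable events), initial states $I\subseteq Q$ and secret states $S\subseteq Q$ with $I\cap S=\emptyset$, together with a security requirement $\ell\colon Q\to\mathbb N$, a clearance function $\gamma\colon\Sigma_p\to\mathbb N$ and a cost function $c\colon\Sigma_p\to\mathbb Q_{\ge 0}$. A policy $\mathcal P\subseteq\Sigma_p$ is *valid* if $\sum_{a\in\mathcal P}\gamma(a)\,|w|_a\ge\ell(q)$ for every string $w$ leading from an initial state to a secret state $q\in S$, where $|w|_a$ is the number of occurrences of $a$ in $w$. It is *$\chi$-valid* if, for all such $w$ and $q$, $\sum_{a\in\mathcal P}\gamma(a)\,\chi_w(a)\ge\ell(q)$, where $\chi_w(a)=1$ if $a$ occurs in $w$ and $\chi_w(a)=0$ otherwise. BC-SPP (resp. BC-$\chi$-SPP) asks, given a system and a budget $W\in\mathbb N$, whether there is a valid (resp. $\chi$-valid) policy $\mathcal P$ with $\sum_{a\in\mathcal P}c(a)\le W$. BC-SPP-U and BC-$\chi$-SPP-U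 are the restrictions of these problems to systems with $\gamma(a)=1$ for all $a\in\Sigma_p$. Numerical values are written in binary. The *exponential time hypothesis* (ETH) states that there is an $\varepsilon>0$ such that no algorithm decides the satisfiability of 3-CNF formulas (clauses with at most three literals, no clause repeated) with $n$ variables in time $O(2^{\varepsilon n})$. **Theorem.** If ETH holds, then none of the problems BC-$\chi$-SPP-U, BC-$\chi$-SPP, BC-SPP-U and BC-SPP can be solved in time $2^{o(N)}$, where $N=|\Sigma_p|$ is the number of protectable events of the system, and not even in time $2^{o(N)}\cdot L^{O(1)}$, where $L$ is the length of the input. That is, for each of the four problems there are no function $f\colon\mathbb N\to\mathbb R$ with $f(N)/N\to 0$ as $N\to\infty$, constant $k\in\mathbb N$ and (multi-stack) Turing machine that decides every instance correctly within $2^{f(N)}\,(L+1)^k$ steps. -/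

import Mathlib

namespace SecretProtection

open Turing Computability Filter Asymptotics
open scoped NNReal

/-! ### Decision problems, deterministic machines and running time -/

/-- Words over `{0,1}`, each followed by the end marker `none`. -/
def encodeWords (ws : List (List Bool)) : List (Option Bool) :=
  ws.flatMap fun w => w.map some ++ [none]

/-- Unary notation, used for indices only. -/
def unary (n : ℕ) : List Bool := List.replicate n true

/-- Binary notation (least significant bit first), used for numerical values. -/
def binary (n : ℕ) : List Bool := n.bits

/-- A decision problem whose instances are written as strings over a fixed finite alphabet
(distinct instances as distinct strings) and carry a natural number parameter. -/
structure DecisionProblem where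
  /-- The instances. -/
  Inst : Type
  /-- The string that represents an instance on the input of a machine. -/
  encode : Inst → List (Option Bool)
  encode_injective : Function.Injective encode
  /-- The parameter in which running times are measured. -/
  param : Inst → ℕ
  /-- The instances with answer "yes". -/
  yes : Inst → Prop

/-- Some multi-stack Turing machine answers every instance `x` of the problem correctly
(output `[true]` or `[false]`) and halts after at most `T x` steps. -/
def DecisionProblem.SolvableInTime (P : DecisionProblem) (T : P.Inst → ℝ) : Prop :=
  ∃ M : TM2ComputableAux (Option Bool) Bool, ∀ x : P.Inst,
    ∃ answer : Bool, (answer = true ↔ P.yes x) ∧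
      ∃ t : ℕ, (t : ℝ) ≤ T x ∧
        Nonempty (TM2OutputsInTime M.tm ((P.encode x).map M.inputAlphabet.invFun)
          (some ([answer].map M.outputAlphabet.invFun)) t)

/-- Solvable in time `2 ^ o(N)`, where `N` is the parameter, up to a factor polynomial in the
length of the input (`k = 0` is the bound `2 ^ o(N)` without such a factor). -/
def DecisionProblem.SolvableInSubexpTime (P : DecisionProblem) : Prop :=
  ∃ f : ℕ → ℝ, f =o[atTop] (fun N : ℕ => (N : ℝ)) ∧
    ∃ k : ℕ, P.SolvableInTime fun x =>
      (2 : ℝ) ^ f (P.param x) * (((P.encode x).length : ℝ) + 1) ^ k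

/-! ### 3-SAT and the exponential time hypothesis -/

/-- A formula in 3-CNF over the variables `0, …, numVars - 1`. A literal is a variable with a
sign (`true`: the variable, `false`: its negation), a clause is a list of at most three literals,
and no clause is listed twice. -/
@[ext] structure CNF3 where
  numVars : ℕ
  clauses : List (List (Fin numVars × Bool))
  length_le : ∀ C ∈ clauses, C.length ≤ 3
  nodup : clauses.Nodup

/-- Some truth assignment makes a literal of every clause true. -/
def CNF3.Satisfiable (φ : CNF3) : Prop :=
  ∃ v : Fin φ.numVars → Bool, ∀ C ∈ φ.clauses, ∃ l ∈ C, v l.1 = l.2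

/-- The number of variables, then the clauses; a literal is its sign followed by the index of its
variable, and the empty word closes each clause. -/
def CNF3.words (φ : CNF3) : List (List Bool) :=
  unary φ.numVars ::
    φ.clauses.flatMap fun C => C.map (fun l => l.2 :: unary l.1) ++ [[]]

def CNF3.encode (φ : CNF3) : List (Option Bool) := encodeWords φ.words

/-! ### Systems with secrets and protecting policies -/

/-- A finite automaton with states `Q`, protectable events `Ep` and unprotectable events `Eu`,
whose accepting states are the secret states, together with a security requirement, a clearance
function and a cost function. Initial states are not secret. -/
structure System (Q Ep Eu : Type) where
  aut : NFA (Ep ⊕ Eu) Q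
  disjoint : Disjoint aut.start aut.accept
  /-- The security requirement (relevant at secret states only). -/
  level : Q → ℕ
  clearance : Ep → ℕ
  cost : Ep → ℝ≥0

/-- The characteristic function of the set of letters that occur in a string. -/
def chi {E : Type} [DecidableEq E] (w : List E) (a : E) : ℕ := if a ∈ w then 1 else 0

/-- Every string leading to a secret state collects enough clearance from its protected events,
each event counted as often as it occurs. -/
def System.Valid {Q Ep Eu : Type} [DecidableEq Ep] [DecidableEq Eu]
    (A : System Q Ep Eu) (P : Finset Ep) : Prop :=
  ∀ (w : List (Ep ⊕ Eu)) (q : Q), q ∈ A.aut.eval w → q ∈ A.aut.accept →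
    A.level q ≤ ∑ a ∈ P, A.clearance a * w.count (Sum.inl a)

/-- Every string leading to a secret state collects enough clearance from its protected events,
each event counted only once. -/
def System.ChiValid {Q Ep Eu : Type} [DecidableEq Ep] [DecidableEq Eu]
    (A : System Q Ep Eu) (P : Finset Ep) : Prop :=
  ∀ (w : List (Ep ⊕ Eu)) (q : Q), q ∈ A.aut.eval w → q ∈ A.aut.accept →
    A.level q ≤ ∑ a ∈ P, A.clearance a * chi w (Sum.inl a)

/-- The cost of a policy. -/
def System.policyCost {Q Ep Eu : Type} (A : System Q Ep Eu) (P : Finset Ep) : ℝ≥0 := ∑ a ∈ P, A.cost a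

/-! ### The budget-constrained secret protection problems -/

/-- The finite data of a system with a budget. Costs are rational, so that they can be written
down; the transition relation is given as a list of triples. -/
@[ext] structure Instance where
  numStates : ℕ
  numProt : ℕ
  numUnprot : ℕ
  alphabet_nonempty : 0 < numProt + numUnprot
  isInitial : Fin numStates → Bool
  isSecret : Fin numStates → Bool
  disjoint : ∀ q, isInitial q = true → isSecret q = false
  level : Fin numStates → ℕ
  clearance : Fin numProt → ℕ
  cost : Fin numProt → ℚ≥0
  transitions : List (Fin numStates × (Fin numProt ⊕ Fin numUnprot) × Fin numStates)
  budget : ℕ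

/-- The system described by an instance. -/
def Instance.system (x : Instance) : System (Fin x.numStates) (Fin x.numProt) (Fin x.numUnprot) where
  aut :=
    { step := fun q a => {q' | (q, a, q') ∈ x.transitions}
      start := {q | x.isInitial q = true}
      accept := {q | x.isSecret q = true} }
  disjoint := by
    refine Set.disjoint_left.2 fun q hi hs => ?_
    have h := x.disjoint q hi
    simp only [Set.mem_ofPred_eq] at hs
    rw [hs] at h
    exact Bool.noConfusion h
  level := x.level
  clearance := x.clearance
  cost a := (x.cost a : ℝ≥0)

/-- Every protectable event has clearance one. -/
def Instance.Uniform (x : Instance) : Prop := ∀ a, x.clearance a = 1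

/-- A valid policy within the budget exists. -/
def Instance.HasValidPolicy (x : Instance) : Prop :=
  ∃ P : Finset (Fin x.numProt), x.system.Valid P ∧ x.system.policyCost P ≤ (x.budget : ℝ≥0)

/-- A `χ`-valid policy within the budget exists. -/
def Instance.HasChiValidPolicy (x : Instance) : Prop :=
  ∃ P : Finset (Fin x.numProt), x.system.ChiValid P ∧ x.system.policyCost P ≤ (x.budget : ℝ≥0)

/-- An event: its kind, then its index. -/
def eventWord {p u : ℕ} : Fin p ⊕ Fin u → List Bool
  | Sum.inl a => true :: unary a
  | Sum.inr b => false :: unary b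

/-- The sizes, the budget, the data of the states, the data of the protectable events and the list
of transitions. -/
def Instance.words (x : Instance) : List (List Bool) :=
  [unary x.numStates, unary x.numProt, unary x.numUnprot, binary x.budget] ++
  ((List.finRange x.numStates).flatMap fun q => [[x.isInitial q, x.isSecret q], binary (x.level q)]) ++
  ((List.finRange x.numProt).flatMap fun a =>
    [binary (x.clearance a), binary (x.cost a).num, binary (x.cost a).den]) ++
  (x.transitions.flatMap fun t => [unary t.1, eventWord t.2.1, unary t.2.2])

def Instance.encode (x : Instance) : List (Option Bool) := encodeWords x.words

/-! ### The encodings are injective -/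

theorem unary_injective : Function.Injective unary := fun m n h => by
  simpa [unary] using congrArg List.length h

theorem binary_injective : Function.Injective binary := fun m n h => by
  have := congrArg (fun l => (l.foldr (fun b k => Nat.bit b k) 0)) h
  have key : ∀ n : ℕ, (n.bits.foldr (fun b k => Nat.bit b k) 0) = n := by
    intro n
    induction n using Nat.binaryRec' with
    | zero => simp
    | bit b n hn ih => rw [Nat.bits_append_bit n b hn]; simp [ih]
  simpa [binary, key] using this

theorem eventWord_injective {p u : ℕ} :
    Function.Injective (eventWord : Fin p ⊕ Fin u → List Bool) := by
  rintro (a | a) (b | b) h <;> simp only [eventWord, List.cons.injEq, reduceCtorEq, false_and,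
    true_and] at h
  · exact congrArg _ (Fin.ext (unary_injective h))
  · exact congrArg _ (Fin.ext (unary_injective h))

/-- A word is determined by any string in which an end marker follows it. -/
theorem marker_inj {α : Type} {f : List α} {g : List α} {s t : List (Option α)}
    (h : f.map some ++ none :: s = g.map some ++ none :: t) : f = g ∧ s = t := by
  induction f generalizing g with
  | nil => cases g with
    | nil => simpa using h
    | cons b g => simp at h
  | cons a f ih => cases g with
    | nil => simp at h
    | cons b g =>
      simp only [List.map_cons, List.cons_append, List.cons.injEq, Option.some.injEq] at h
      obtain ⟨h1, h2⟩ := ih h.2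
      exact ⟨by rw [h.1, h1], h2⟩

theorem encodeWords_injective : Function.Injective encodeWords := by
  intro v
  induction v with
  | nil => intro w h; cases w <;> simp_all [encodeWords]
  | cons a v ih =>
    intro w h
    cases w with
    | nil => simp [encodeWords] at h
    | cons b w =>
      simp only [encodeWords, List.flatMap_cons, List.append_assoc, List.singleton_append] at h
      obtain ⟨h1, h2⟩ := marker_inj h
      rw [h1, ih h2]

theorem clauses_inj {n : ℕ} :
    Function.Injective fun l : List (List (Fin n × Bool)) =>
      l.flatMap fun C => C.map (fun l => l.2 :: unary l.1) ++ [[]] := by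
  have lit : ∀ {f g : List (Fin n × Bool)} {s t : List (List Bool)},
      f.map (fun l => l.2 :: unary l.1) ++ [] :: s = g.map (fun l => l.2 :: unary l.1) ++ [] :: t →
        f = g ∧ s = t := by
    intro f
    induction f with
    | nil => intro g s t h; cases g <;> simp_all
    | cons a f ih =>
      intro g s t h
      cases g with
      | nil => simp at h
      | cons b g =>
        simp only [List.map_cons, List.cons_append, List.cons.injEq] at h
        obtain ⟨h1, h2⟩ := ih h.2
        exact ⟨by rw [h1, Prod.ext (Fin.ext (unary_injective h.1.2)) h.1.1], h2⟩
  intro v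
  induction v with
  | nil => intro w h; cases w <;> simp_all
  | cons a v ih =>
    intro w h
    cases w with
    | nil => simp at h
    | cons b w =>
      simp only [List.flatMap_cons, List.append_assoc, List.singleton_append] at h
      obtain ⟨h1, h2⟩ := lit h
      rw [h1, ih h2]

theorem CNF3.encode_injective : Function.Injective CNF3.encode := by
  rintro ⟨n, C, h1, h2⟩ ⟨n', C', h1', h2'⟩ h
  have h := encodeWords_injective h
  simp only [CNF3.words, List.cons.injEq] at h
  obtain ⟨hn, hC⟩ := h
  obtain rfl := unary_injective hn
  obtain rfl := clauses_inj hC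
  rfl

theorem flatMap_inj {α β : Type} {f g : α → List β} {n : ℕ} (hf : ∀ a, (f a).length = n)
    (hg : ∀ a, (g a).length = n) :
    ∀ {l : List α}, l.flatMap f = l.flatMap g → ∀ a ∈ l, f a = g a := by
  intro l
  induction l with
  | nil => simp
  | cons b l ih =>
    intro h
    simp only [List.flatMap_cons] at h
    obtain ⟨h1, h2⟩ := List.append_inj h (by rw [hf, hg])
    intro a ha
    rcases List.mem_cons.1 ha with rfl | ha
    · exact h1
    · exact ih h2 a ha

theorem transitions_inj {q p u : ℕ} :
    Function.Injective fun l : List (Fin q × (Fin p ⊕ Fin u) × Fin q) =>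
      l.flatMap fun t => [unary t.1, eventWord t.2.1, unary t.2.2] := by
  intro v
  induction v with
  | nil => intro w h; cases w <;> simp_all
  | cons a v ih =>
    intro w h
    cases w with
    | nil => simp at h
    | cons b w =>
      simp only [List.flatMap_cons, List.cons_append, List.nil_append, List.cons.injEq] at h
      obtain ⟨h1, h2, h3, h4⟩ := h
      rw [ih h4, Prod.ext (Fin.ext (unary_injective h1))
        (Prod.ext (eventWord_injective h2) (Fin.ext (unary_injective h3)))]

theorem Instance.encode_injective : Function.Injective Instance.encode := by
  rintro ⟨q, p, u, hne, i, s, hd, l, g, c, δ, W⟩ ⟨q', p', u', hne', i', s', hd', l', g', c', δ', W'⟩ h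
  have h := encodeWords_injective h
  simp only [Instance.words, List.cons_append, List.nil_append, List.cons.injEq,
    List.append_assoc] at h
  obtain ⟨h1, h2, h3, h4, h5⟩ := h
  obtain rfl := unary_injective h1
  obtain rfl := unary_injective h2
  obtain rfl := unary_injective h3
  obtain rfl := binary_injective h4
  obtain ⟨h6, h7⟩ := List.append_inj h5 (by simp)
  obtain ⟨h8, h9⟩ := List.append_inj h7 (by simp)
  obtain rfl := transitions_inj h9
  have hq := fun a => flatMap_inj (n := 2) (by simp) (by simp) h6 a (List.mem_finRange a)
  have hp := fun a => flatMap_inj (n := 3) (by simp) (by simp) h8 a (List.mem_finRange a)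
  simp only [List.cons.injEq, and_true] at hq hp
  obtain rfl : i = i' := funext fun a => (hq a).1.1
  obtain rfl : s = s' := funext fun a => (hq a).1.2
  obtain rfl : l = l' := funext fun a => binary_injective (hq a).2
  obtain rfl : g = g' := funext fun a => binary_injective (hp a).1
  obtain rfl : c = c' := funext fun a =>
    NNRat.ext_num_den (binary_injective (hp a).2.1) (binary_injective (hp a).2.2)
  rfl

/-! ### The problems -/

/-- 3-SAT, parameterized by the number of variables. -/
def threeSAT : DecisionProblem where
  Inst := CNF3
  encode := CNF3.encode
  encode_injective := CNF3.encode_injective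
  param := CNF3.numVars
  yes := CNF3.Satisfiable

/-- The exponential time hypothesis: for some `ε > 0`, 3-SAT cannot be solved in time
`O(2 ^ (ε n))`, where `n` is the number of variables. -/
def ETH : Prop :=
  ∃ ε : ℝ, 0 < ε ∧
    ¬ ∃ C : ℝ, threeSAT.SolvableInTime fun φ => C * (2 : ℝ) ^ (ε * (threeSAT.param φ : ℝ))

/-- BC-SPP, parameterized by the number of protectable events. -/
def bcSPP : DecisionProblem where
  Inst := Instance
  encode := Instance.encode
  encode_injective := Instance.encode_injective
  param := Instance.numProt
  yes := Instance.HasValidPolicy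

/-- BC-`χ`-SPP, parameterized by the number of protectable events. -/
def bcChiSPP : DecisionProblem where
  Inst := Instance
  encode := Instance.encode
  encode_injective := Instance.encode_injective
  param := Instance.numProt
  yes := Instance.HasChiValidPolicy

/-- BC-SPP-U: BC-SPP restricted to the instances with uniform clearance one. -/
def bcSPPU : DecisionProblem where
  Inst := {x : Instance // x.Uniform}
  encode x := x.1.encode
  encode_injective := Instance.encode_injective.comp Subtype.val_injective
  param x := x.1.numProt
  yes x := x.1.HasValidPolicy

/-- BC-`χ`-SPP-U: BC-`χ`-SPP restricted to the instances with uniform clearance one. -/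
def bcChiSPPU : DecisionProblem where
  Inst := {x : Instance // x.Uniform}
  encode x := x.1.encode
  encode_injective := Instance.encode_injective.comp Subtype.val_injective
  param x := x.1.numProt
  yes x := x.1.HasChiValidPolicy

end SecretProtection

namespace SecretProtection

open Turing Computability StateTransition
open scoped NNReal

/-! ### Composition of multi-stack Turing machines -/

/-! 3-SAT over n variables is reduced to all four problems with only N = 2n protectable events, one
per literal. An unprotectable event leads from the initial state into each clause, whose literals
are then read one after the other up to a secret state. Levels and clearances are one, so a policy
is valid, and equally χ-valid, exactly when it protects a literal of each clause
(`valid_clauseInstance_iff`, `chiValid_clauseInstance_iff`). The instances are uniform, so one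
reduction serves all four problems.

To the clauses of the formula one adds ¬xᵢ ∨ xᵢ for each i. A policy that hits these contains the
true literals of some assignment. Both literals of xᵢ cost 2^(n-1-i) and the budget is 2^n - 1, the
exact cost of every assignment, so the policy contains nothing else, and hitting the other clauses
means satisfying the formula (`CNF3.satisfiable_iff`). Unit costs with budget n would also work;
powers of two are convenient because 2^n - 1 is n ones in binary, which a machine writes without
arithmetic.

Clauses have at most three literals and are not repeated, so there are O(n³) of them and the
instance has length L = O(n⁶). An explicit stack machine writes it in O(n⁶) steps
(`reductionMachine_outputs_toInstance`), and composing two machines costs only linear time in the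
intermediate word (`outputs_composeMachine`). A solver with time 2^f(2n) · (L+1)^k, where f = o(N),
would therefore decide 3-SAT in time O(2^(εn)) for every ε > 0, against ETH
(`not_solvableInSubexpTime`). -/

/-- The partial function `f` leads from `a` to `b` in exactly `n` steps. -/
def ReachesIn {α : Type} (f : α → Option α) (n : ℕ) (a b : α) : Prop :=
  (flip bind f)^[n] (some a) = some b

namespace ReachesIn

variable {α β : Type} {f : α → Option α} {m n : ℕ} {a b c : α}

theorem refl (f : α → Option α) (a : α) : ReachesIn f 0 a a := rfl

theorem trans (h₁ : ReachesIn f m a b) (h₂ : ReachesIn f n b c) : ReachesIn f (m + n) a c := by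
  unfold ReachesIn at *
  rw [add_comm, Function.iterate_add_apply, h₁, h₂]

theorem single (h : f a = some b) : ReachesIn f 1 a b := h

theorem head (h : f a = some b) (h₂ : ReachesIn f n b c) : ReachesIn f (n + 1) a c := by
  rw [add_comm]
  exact (single h).trans h₂

theorem exists_of_succ (h : ReachesIn f (n + 1) a c) : ∃ b, f a = some b ∧ ReachesIn f n b c := by
  have key : ∀ n, (flip bind f)^[n] none = none := fun n => by
    induction n with
    | zero => rfl
    | succ n ih => rw [Function.iterate_succ_apply]; exact ih
  unfold ReachesIn at h
  rw [Function.iterate_succ_apply] at h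
  cases hb : f a with
  | none =>
    have : flip bind f (some a) = none := hb
    rw [this, key] at h
    exact absurd h (by simp)
  | some b =>
    have : flip bind f (some a) = some b := hb
    rw [this] at h
    exact ⟨b, rfl, h⟩

theorem map {g : β → Option β} (φ : α → β) (hφ : ∀ a b, f a = some b → g (φ a) = some (φ b))
    (h : ReachesIn f n a b) : ReachesIn g n (φ a) (φ b) := by
  induction n generalizing a with
  | zero =>
    obtain rfl : a = b := Option.some_injective _ h
    rfl
  | succ n ih =>
    obtain ⟨c, hc, hcb⟩ := h.exists_of_succ
    exact head (hφ _ _ hc) (ih hcb)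

end ReachesIn

/-- The definition casts along an equality of stack indices; in the `Function.update` form the
update lemmas for stacks apply. -/
theorem initList_eq (tm : FinTM2) (s : List (tm.Γ tm.k₀)) :
    initList tm s = ⟨some tm.main, tm.initialState, Function.update (fun _ => []) tm.k₀ s⟩ := by
  unfold initList
  congr 1
  funext k
  by_cases h : k = tm.k₀
  · subst h; simp
  · simp [h]

theorem haltList_eq (tm : FinTM2) (s : List (tm.Γ tm.k₁)) :
    haltList tm s = ⟨none, tm.initialState, Function.update (fun _ => []) tm.k₁ s⟩ := by
  unfold haltList
  congr 1
  funext k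
  by_cases h : k = tm.k₁
  · subst h; simp
  · simp [h]

/-! ### Simulation of a machine inside a larger one -/

section Lift

variable {K K' Λ Λ' σ σ' : Type} {Γ' : K' → Type}

/-- A statement of a machine, run inside a machine with more stacks, labels and states; where the
original machine halts, the new one goes to the label `exit` (or halts if there is none). -/
def liftStmt (emb : K → K') (lab : Λ → Λ') (exit : Option Λ') (get : σ' → σ) (put : σ → σ' → σ') :
    TM2.Stmt (fun k => Γ' (emb k)) Λ σ → TM2.Stmt Γ' Λ' σ'
  | .push k f q => .push (emb k) (fun v => f (get v)) (liftStmt emb lab exit get put q)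
  | .peek k f q => .peek (emb k) (fun v o => put (f (get v) o) v) (liftStmt emb lab exit get put q)
  | .pop k f q => .pop (emb k) (fun v o => put (f (get v) o) v) (liftStmt emb lab exit get put q)
  | .load f q => .load (fun v => put (f (get v)) v) (liftStmt emb lab exit get put q)
  | .branch f q₁ q₂ => .branch (fun v => f (get v)) (liftStmt emb lab exit get put q₁)
      (liftStmt emb lab exit get put q₂)
  | .goto f => .goto fun v => lab (f (get v))
  | .halt => match exit with
    | none => .halt
    | some l => .goto fun _ => l

/-- The configuration of the larger machine that corresponds to a configuration of the smaller one. -/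
def liftCfg {emb : K → K'} (lab : Λ → Λ') (exit : Option Λ') (inj : σ → σ')
    (glue : (∀ k, List (Γ' (emb k))) → ∀ k', List (Γ' k'))
    (c : TM2.Cfg (fun k => Γ' (emb k)) Λ σ) : TM2.Cfg Γ' Λ' σ' :=
  ⟨c.l.elim exit fun l => some (lab l), inj c.var, glue c.stk⟩

/-- The hypotheses say that `inj` and `glue` embed states and stacks compatibly with reading and
writing, so every primitive statement commutes with the embedding. The only change is at `halt`,
which `liftCfg` sends to `exit`. -/
theorem stepAux_liftStmt [DecidableEq K] [DecidableEq K'] {emb : K → K'} {lab : Λ → Λ'}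
    {exit : Option Λ'} {get : σ' → σ} {put : σ → σ' → σ'} {inj : σ → σ'}
    {glue : (∀ k, List (Γ' (emb k))) → ∀ k', List (Γ' k')}
    (hget : ∀ v, get (inj v) = v) (hput : ∀ v w, put w (inj v) = inj w)
    (hglue : ∀ S k, glue S (emb k) = S k)
    (hupd : ∀ S k l, Function.update (glue S) (emb k) l = glue (Function.update S k l))
    (q : TM2.Stmt (fun k => Γ' (emb k)) Λ σ) (v : σ) (S : ∀ k, List (Γ' (emb k))) :
    TM2.stepAux (liftStmt emb lab exit get put q) (inj v) (glue S) =
      liftCfg lab exit inj glue (TM2.stepAux q v S) := by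
  induction q generalizing v S with
  | push k f q ih => simp only [liftStmt, TM2.stepAux, hglue, hupd, hget, ih]
  | peek k f q ih => simp only [liftStmt, TM2.stepAux, hglue, hget, hput, ih]
  | pop k f q ih => simp only [liftStmt, TM2.stepAux, hglue, hupd, hget, hput, ih]
  | load f q ih => simp only [liftStmt, TM2.stepAux, hget, hput, ih]
  | branch f q₁ q₂ ih₁ ih₂ =>
    simp only [liftStmt, TM2.stepAux, hget]
    cases f v
    · exact ih₂ v S
    · exact ih₁ v S
  | goto f => simp only [liftStmt, TM2.stepAux, hget]; rfl
  | halt => cases exit <;> rfl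

end Lift

section Move

variable {K Λ σ : Type} {Γ : K → Type}

/-- Move one symbol from the stack `k` to the stack `k'`; go to `loop`, or to `next` if there was
none. -/
def moveStmt (k k' : K) (read : σ → Option (Γ k) → σ) (test : σ → Bool) (write : σ → Γ k')
    (loop next : Λ) : TM2.Stmt Γ Λ σ :=
  .pop k read <| .branch test (.push k' write <| .goto fun _ => loop) (.goto fun _ => next)

variable [DecidableEq K] {k k' : K} {read : σ → Option (Γ k) → σ} {test : σ → Bool}
  {write : σ → Γ k'} {loop next : Λ} {S : ∀ k, List (Γ k)} {v : σ}

theorem stepAux_moveStmt_cons {a : Γ k} {s : List (Γ k)} (hS : S k = a :: s)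
    (h : test (read v (some a)) = true) (hk : k' ≠ k) :
    TM2.stepAux (moveStmt k k' read test write loop next) v S =
      ⟨some loop, read v (some a),
        Function.update (Function.update S k s) k' (write (read v (some a)) :: S k')⟩ := by
  simp [moveStmt, hS, h, hk]

theorem stepAux_moveStmt_nil (hS : S k = []) (h : test (read v none) = false) :
    TM2.stepAux (moveStmt k k' read test write loop next) v S = ⟨some next, read v none, S⟩ := by
  simp only [moveStmt, TM2.stepAux, hS, List.head?_nil, h, List.tail_nil, cond_false]
  rw [← hS, Function.update_eq_self]

end Move

/-! ### The composite machine -/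

section Compose

variable (A M : FinTM2) {α : Type} [Inhabited α]
  (eA : A.Γ A.k₁ ≃ α) (eM : M.Γ M.k₀ ≃ α)

/-- The stacks of the composite machine. -/
abbrev composeStack : A.K ⊕ M.K ⊕ Unit → Type :=
  Sum.elim A.Γ (Sum.elim M.Γ fun _ => α)

/-- Labels of the composite machine: those of the first machine, two labels for moving the
intermediate result, and those of the second machine. -/
abbrev ComposeLabel : Type := A.Λ ⊕ Bool ⊕ M.Λ

abbrev ComposeState (α : Type) : Type := A.σ × M.σ × Option α

/-- Run the first machine, move its output to the auxiliary stack and from there to the input stack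
of the second machine, and run that. -/
def composeProg : ComposeLabel A M →
    TM2.Stmt (composeStack (α := α) A M) (ComposeLabel A M) (ComposeState A M α)
  | .inl l => liftStmt (K := A.K) (Γ' := composeStack (α := α) A M) Sum.inl Sum.inl
      (some (.inr (.inl false))) (fun v => v.1) (fun w v => (w, v.2)) (A.m l)
  | .inr (.inl false) => moveStmt (Γ := composeStack (α := α) A M) (.inl A.k₁) (.inr (.inr ()))
      (fun v o => (v.1, v.2.1, o.map eA)) (fun v => v.2.2.isSome) (fun v => v.2.2.getD default)
      (.inr (.inl false)) (.inr (.inl true))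
  | .inr (.inl true) => moveStmt (Γ := composeStack (α := α) A M) (.inr (.inr ())) (.inr (.inl M.k₀))
      (fun v o => (v.1, v.2.1, o)) (fun v => v.2.2.isSome)
      (fun v => eM.symm (v.2.2.getD default)) (.inr (.inl true)) (.inr (.inr M.main))
  | .inr (.inr l) => liftStmt (K := M.K) (Γ' := composeStack (α := α) A M)
      (fun k => .inr (.inl k)) (fun l => .inr (.inr l)) none
      (fun v => v.2.1) (fun w v => (v.1, w, v.2.2)) (M.m l)

/-- The composite machine. -/
def composeMachine [Fintype α] : FinTM2 where
  K := A.K ⊕ M.K ⊕ Unit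
  kFin := letI := A.kFin; letI := M.kFin; inferInstance
  k₀ := .inl A.k₀
  k₁ := .inr (.inl M.k₁)
  Γ := composeStack (α := α) A M
  Λ := ComposeLabel A M
  main := .inl A.main
  ΛFin := letI := A.ΛFin; letI := M.ΛFin; inferInstance
  σ := ComposeState A M α
  initialState := (A.initialState, M.initialState, none)
  σFin := letI := A.σFin; letI := M.σFin; inferInstance
  Γk₀Fin := A.Γk₀Fin
  m := composeProg A M eA eM

section Stacks

variable {A M : FinTM2} {α : Type}

/-- The contents of all stacks of the composite machine. -/
def joinStacks (S : ∀ k, List (A.Γ k)) (S' : ∀ k, List (M.Γ k)) (l : List α) :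
    ∀ k, List (composeStack (α := α) A M k)
  | .inl k => S k
  | .inr (.inl k) => S' k
  | .inr (.inr _) => l

theorem update_joinStacks_left (S : ∀ k, List (A.Γ k)) (S' : ∀ k, List (M.Γ k)) (l : List α)
    (k : A.K) (s : List (A.Γ k)) :
    Function.update (joinStacks S S' l) (.inl k) s = joinStacks (Function.update S k s) S' l := by
  funext k'
  rcases k' with k' | k' | k'
  · by_cases h : k' = k
    · subst h
      exact (Function.update_self ..).trans (Function.update_self (β := fun k => List (A.Γ k)) ..).symm
    · exact (Function.update_of_ne (fun e => h (Sum.inl.inj e)) ..).trans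
        (Function.update_of_ne (β := fun k => List (A.Γ k)) h ..).symm
  · exact Function.update_of_ne Sum.inr_ne_inl ..
  · exact Function.update_of_ne Sum.inr_ne_inl ..

theorem update_joinStacks_right (S : ∀ k, List (A.Γ k)) (S' : ∀ k, List (M.Γ k)) (l : List α)
    (k : M.K) (s : List (M.Γ k)) :
    Function.update (joinStacks S S' l) (.inr (.inl k)) s =
      joinStacks S (Function.update S' k s) l := by
  funext k'
  rcases k' with k' | k' | k'
  · exact Function.update_of_ne Sum.inl_ne_inr ..
  · by_cases h : k' = k
    · subst h
      exact (Function.update_self ..).trans (Function.update_self (β := fun k => List (M.Γ k)) ..).symm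
    · exact (Function.update_of_ne (fun e => h (Sum.inl.inj (Sum.inr.inj e))) ..).trans
        (Function.update_of_ne (β := fun k => List (M.Γ k)) h ..).symm
  · exact Function.update_of_ne (fun e => Sum.inr_ne_inl (Sum.inr.inj e)) ..

theorem update_joinStacks_aux (S : ∀ k, List (A.Γ k)) (S' : ∀ k, List (M.Γ k)) (l s : List α) :
    Function.update (joinStacks S S' l) (.inr (.inr ())) s = joinStacks S S' s := by
  funext k'
  rcases k' with k' | k' | k'
  · exact Function.update_of_ne Sum.inl_ne_inr ..
  · exact Function.update_of_ne (fun e => Sum.inl_ne_inr (Sum.inr.inj e)) ..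
  · exact Function.update_self ..

end Stacks

variable {A M}

/-- One step of the composite machine. -/
abbrev composeStep := TM2.step (composeProg A M eA eM)

/-- A halted configuration of `A` is represented by the label that starts the unloading, so the end
of the first run is already the start of the next phase. The data of `M` and the auxiliary stack
stay frozen. -/
theorem reachesIn_compose_first {n : ℕ} {c c' : A.Cfg} (h : ReachesIn A.step n c c')
    (w : M.σ) (o : Option α) (S' : ∀ k, List (M.Γ k)) (l : List α) :
    ReachesIn (composeStep eA eM) n
      ⟨c.l.elim (some (.inr (.inl false))) fun l => some (.inl l), (c.var, w, o),
        joinStacks c.stk S' l⟩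
      ⟨c'.l.elim (some (.inr (.inl false))) fun l => some (.inl l), (c'.var, w, o),
        joinStacks c'.stk S' l⟩ := by
  refine h.map (fun c : A.Cfg => liftCfg (Λ' := ComposeLabel A M)
    (Γ' := composeStack (α := α) A M) (emb := Sum.inl) Sum.inl
    (some (.inr (.inl false))) (fun v => (v, w, o)) (fun S => joinStacks S S' l) c) ?_
  rintro ⟨_ | lb, v, S⟩ b hb
  · exact absurd hb (by simp [FinTM2.step, TM2.step])
  · obtain rfl := Option.some_injective _ hb
    exact congrArg some (stepAux_liftStmt (Γ' := composeStack (α := α) A M) (emb := Sum.inl)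
      (glue := fun S => joinStacks S S' l) (inj := fun v => (v, w, o))
      (fun _ => rfl) (fun _ _ => rfl) (fun _ _ => rfl)
      (fun S k s => update_joinStacks_left S S' l k s) (A.m lb) v S)

theorem reachesIn_compose_second {n : ℕ} {c c' : M.Cfg} (h : ReachesIn M.step n c c')
    (w : A.σ) (o : Option α) (S : ∀ k, List (A.Γ k)) (l : List α) :
    ReachesIn (composeStep eA eM) n
      ⟨c.l.map fun l => .inr (.inr l), (w, c.var, o), joinStacks S c.stk l⟩
      ⟨c'.l.map fun l => .inr (.inr l), (w, c'.var, o), joinStacks S c'.stk l⟩ := by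
  have key : ∀ c : M.Cfg, (⟨c.l.map fun l => .inr (.inr l), (w, c.var, o), joinStacks S c.stk l⟩ :
      TM2.Cfg (composeStack (α := α) A M) (ComposeLabel A M) (ComposeState A M α)) =
      liftCfg (Γ' := composeStack (α := α) A M) (emb := fun k => .inr (.inl k))
        (fun l => .inr (.inr l)) none (fun v => (w, v, o)) (fun S' => joinStacks S S' l) c := by
    rintro ⟨_ | _, _, _⟩ <;> rfl
  rw [key, key]
  refine h.map _ ?_
  rintro ⟨_ | lb, v, S'⟩ b hb
  · exact absurd hb (by simp [FinTM2.step, TM2.step])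
  · obtain rfl := Option.some_injective _ hb
    exact congrArg some (stepAux_liftStmt (Γ' := composeStack (α := α) A M)
      (emb := fun k => .inr (.inl k))
      (glue := fun S' => joinStacks S S' l) (inj := fun v => (w, v, o))
      (fun _ => rfl) (fun _ _ => rfl) (fun _ _ => rfl)
      (fun S' k s => update_joinStacks_right S S' l k s) (M.m lb) v S')

/-- Moving a stack reverses it; `reachesIn_compose_load` reverses it again, so `M` receives the
intermediate word in its original order. -/
theorem reachesIn_compose_unload (s : List (A.Γ A.k₁)) (v : A.σ) (w : M.σ) (o : Option α)
    (l : List α) :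
    ReachesIn (composeStep eA eM) (s.length + 1)
      ⟨some (.inr (.inl false)), (v, w, o),
        joinStacks (Function.update (fun _ => []) A.k₁ s) (fun _ => []) l⟩
      ⟨some (.inr (.inl true)), (v, w, none),
        joinStacks (fun _ => []) (fun _ => []) ((s.map eA).reverse ++ l)⟩ := by
  induction s generalizing o l with
  | nil =>
    refine ReachesIn.single (congrArg some ((stepAux_moveStmt_nil ?_ rfl).trans ?_))
    · simp [joinStacks]
    · simp
  | cons a s ih =>
    have e : Function.update (Function.update (joinStacks (Function.update (fun _ => []) A.k₁ (a :: s))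
        (fun _ => []) l) (.inl A.k₁) s) (.inr (.inr ())) (eA a :: l) =
        joinStacks (Function.update (fun _ => []) A.k₁ s) (fun _ : M.K => []) (eA a :: l) := by
      refine (congrArg (fun T => Function.update T _ _) ((update_joinStacks_left _ _ _ _ s).trans
        (congrArg (fun S => joinStacks S _ _) ?_))).trans (update_joinStacks_aux _ _ _ (eA a :: l))
      exact Function.update_idem ..
    have e' : joinStacks (Function.update (fun _ => []) A.k₁ (a :: s)) (fun _ : M.K => []) l
        (.inl A.k₁) = a :: s :=
      Function.update_self (β := fun k => List (A.Γ k)) A.k₁ (a :: s) (fun _ => [])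
    refine ReachesIn.head (congrArg some ((stepAux_moveStmt_cons (Γ := composeStack (α := α) A M)
      (k := .inl A.k₁) (a := a) (s := s) e' rfl ?_).trans (congrArg (TM2.Cfg.mk _ _) e))) ?_
    · simp
    · simpa using ih (some (eA a)) (eA a :: l)

theorem reachesIn_compose_load (s : List α) (v : A.σ) (w : M.σ) (o : Option α)
    (l : List (M.Γ M.k₀)) :
    ReachesIn (composeStep eA eM) (s.length + 1)
      ⟨some (.inr (.inl true)), (v, w, o),
        joinStacks (fun _ => []) (Function.update (fun _ => []) M.k₀ l) s⟩
      ⟨some (.inr (.inr M.main)), (v, w, none),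
        joinStacks (fun _ => [])
          (Function.update (fun _ => []) M.k₀ ((s.map eM.symm).reverse ++ l)) []⟩ := by
  induction s generalizing o l with
  | nil =>
    refine ReachesIn.single (congrArg some ((stepAux_moveStmt_nil rfl rfl).trans ?_))
    simp
  | cons a s ih =>
    have e : Function.update (Function.update (joinStacks (fun _ : A.K => [])
        (Function.update (fun _ => []) M.k₀ l) (a :: s)) (.inr (.inr ())) s) (.inr (.inl M.k₀))
        (eM.symm a :: Function.update (β := fun k => List (M.Γ k)) (fun _ => []) M.k₀ l M.k₀) =
        joinStacks (fun _ : A.K => []) (Function.update (fun _ => []) M.k₀ (eM.symm a :: l)) s := by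
      refine (congrArg (fun T => Function.update T _ _) (update_joinStacks_aux _ _ _ s)).trans
        ((update_joinStacks_right _ _ _ _ _).trans (congrArg (fun S => joinStacks _ S _) ?_))
      refine (Function.update_idem (β := fun k => List (M.Γ k)) ..).trans
        (congrArg (fun s => Function.update (fun _ => []) M.k₀ (eM.symm a :: s)) ?_)
      exact Function.update_self (β := fun k => List (M.Γ k)) ..
    refine ReachesIn.head (congrArg some ((stepAux_moveStmt_cons (Γ := composeStack (α := α) A M)
      (k := .inr (.inr ())) (a := a) (s := s) rfl rfl ?_).trans
      (congrArg (TM2.Cfg.mk _ _) e))) ?_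
    · simp
    · simpa using ih (some a) (eM.symm a :: l)

/-- Four runs are concatenated: `A`, two moves of `y.length + 1` steps each, and `M`. They fit
together because `haltList` requires the internal state to be initial again and every stack but the
output to be empty. -/
theorem outputs_composeMachine [Fintype α] {x : List (A.Γ A.k₀)} {y : List α} {z : List (M.Γ M.k₁)} {n n' : ℕ}
    (hA : TM2OutputsInTime A x (some (y.map eA.symm)) n)
    (hM : TM2OutputsInTime M (y.map eM.symm) (some z) n') :
    Nonempty (TM2OutputsInTime (composeMachine A M eA eM) x (some z)
      (n + n' + 2 * (y.length + 1))) := by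
  have hA' : ReachesIn A.step hA.steps _ _ := hA.evals_in_steps
  have hM' : ReachesIn M.step hM.steps _ _ := hM.evals_in_steps
  have h₁ := reachesIn_compose_first eA eM hA' M.initialState none (fun _ => []) []
  have h₂ := reachesIn_compose_unload (M := M) eA eM (y.map eA.symm) A.initialState M.initialState
    none []
  have h₃ := reachesIn_compose_load (A := A) eA eM y.reverse A.initialState M.initialState none []
  have h₄ := reachesIn_compose_second eA eM hM' A.initialState none (fun _ => []) []
  simp only [initList_eq, haltList_eq, Option.elim_none, Option.elim_some, Option.map_some,
    Option.map_none] at h₁ h₄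
  simp only [List.map_map, Equiv.self_comp_symm, List.map_id, List.append_nil, List.length_map,
    List.length_reverse, List.map_reverse, List.reverse_reverse, Function.update_eq_self] at h₂ h₃
  have h := ((h₁.trans h₂).trans h₃).trans h₄
  have hle₁ := hA.steps_le_m
  have hle₂ := hM.steps_le_m
  rw [← update_joinStacks_left, ← update_joinStacks_right] at h
  have e : joinStacks (fun k => ([] : List (A.Γ k))) (fun k => ([] : List (M.Γ k))) ([] : List α) =
      fun _ => [] := by
    funext k
    rcases k with k | k | k <;> rfl
  rw [e] at h
  have hx := initList_eq (composeMachine A M eA eM) x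
  have hz := haltList_eq (composeMachine A M eA eM) z
  refine ⟨⟨⟨hA.steps + (y.length + 1) + (y.length + 1) + hM.steps, ?_⟩, ?_⟩⟩
  · exact (congrArg (fun c => _^[_] (some c)) hx).trans (Eq.trans h (congrArg some hz).symm)
  · dsimp only
    omega

end Compose

/-! ### The reduction machine -/

/-- The stacks of the reduction machine: the input, a counter, an auxiliary stack for copying the
counter, five sections of the output, and the output. -/
inductive Tape
  | inp | counter | spare | sizes | header | states | events | moves | out
  deriving DecidableEq

instance : Fintype Tape where
  elems := {.inp, .counter, .spare, .sizes, .header, .states, .events, .moves, .out}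
  complete k := by cases k <;> simp

/-- Labels of the reduction machine. -/
inductive Label
  | readVars | tautology | tautologyNeg | tautologyPos | word | literal (s : Bool) | variable
  | clauseEnd | target | clear | collect (k : Tape)
  deriving Fintype

abbrev Command : Type := TM2.Stmt (fun _ : Tape => Option Bool) Label (Option (Option Bool))

/-- Push the symbols of a list, the first one first. -/
def pushes (k : Tape) (l : List (Option Bool)) (q : Command) : Command :=
  l.foldr (fun a q => .push k (fun _ => a) q) q

/-- Pop a symbol and continue according to whether the stack was empty, the symbol was the end
marker, or it was a bit. -/
def onPop (k : Tape) (empty marker : Command) (bit : Bool → Command) : Command :=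
  .pop k (fun _ o => o) <|
    .branch (fun v => v == none) empty <|
      .branch (fun v => v == some none) marker <|
        .branch (fun v => v == some (some true)) (bit true) (bit false)

/-- Where the collection of the output goes on after the given section. -/
def nextSection : Tape → Command
  | .moves => .goto fun _ => .collect .events
  | .events => .goto fun _ => .collect .states
  | .states => .goto fun _ => .collect .header
  | .header => .goto fun _ => .collect .sizes
  | _ => .halt

/-- The program of the reduction machine. It prepends to the clauses the tautologies over each
variable, and then translates the resulting sequence of words into a system. The five sections are
the number of states, the other sizes with the budget, the data of the states, the data of the
protectable events, and the transitions. -/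
def reductionProg : Label → Command
  -- None of the `.halt` branches below is reached on the encoding of a formula.
  | .readVars => onPop .inp .halt
      (pushes .header [none, some true, none] <| .goto fun _ => .tautology)
      fun _ => pushes .counter [some true] <| pushes .header [some true, some true] <|
        .goto fun _ => .readVars
  | .tautology => onPop .counter
      -- The marker closes the budget. There are two states more than tokens. State 0 is initial,
      -- not secret, of level one, with a transition to state 1; the counter now holds 1, the state
      -- in front of the first token.
      (pushes .header [none] <| pushes .sizes [some true, some true] <|
        pushes .states [some true, some false, none, some true, none] <|
        pushes .moves [none, some false, none, some true, none] <|
        pushes .counter [some true] <| .goto fun _ => .word)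
      .halt
      fun _ => pushes .header [some true] <| pushes .inp [none, none] <|
        pushes .events [some true, none] <| .goto fun _ => .tautologyNeg
  | .tautologyNeg => onPop .counter
      (pushes .inp [some true, none] <|
        pushes .events [some true, none, some true, none, some true, none] <|
        .goto fun _ => .tautologyPos)
      .halt
      fun _ => pushes .spare [some true] <| pushes .inp [some true] <|
        pushes .events [some false] <| .goto fun _ => .tautologyNeg
  | .tautologyPos => onPop .spare
      (pushes .inp [some false] <| pushes .events [some true, none, some true, none] <|
        .goto fun _ => .tautology)
      .halt
      fun _ => pushes .counter [some true] <| pushes .inp [some true] <|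
        pushes .events [some false] <| .goto fun _ => .tautologyPos
  | .word => onPop .inp
      (pushes .sizes [none] <| pushes .states [some false, some false, none, some true, none] <|
        .goto fun _ => .clear)
      (pushes .sizes [some true] <| pushes .states [some false, some true, none, some true, none] <|
        pushes .moves [none, some false, none] <| .goto fun _ => .clauseEnd)
      fun s => pushes .sizes [some true] <|
        pushes .states [some false, some false, none, some true, none] <| .goto fun _ => .literal s
  | .literal s => onPop .counter
      -- The event index 2i + s is written in unary: first the s marks of the sign, then two marks
      -- for each mark of i.
      (pushes .moves ([none, some true] ++ List.replicate s.toNat (some true)) <|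
        .goto fun _ => .variable)
      .halt
      fun _ => pushes .spare [some true] <| pushes .moves [some true] <| .goto fun _ => .literal s
  | .variable => onPop .inp .halt
      -- The extra mark makes the target state the successor of the source.
      (pushes .moves [none] <| pushes .spare [some true] <| .goto fun _ => .target)
      fun _ => pushes .moves [some true, some true] <| .goto fun _ => .variable
  | .clauseEnd => onPop .counter
      (pushes .spare [some true] <| .goto fun _ => .target)
      .halt
      fun _ => pushes .spare [some true] <| .goto fun _ => .clauseEnd
  | .target => onPop .spare
      (pushes .moves [none] <| .goto fun _ => .word)
      .halt
      fun _ => pushes .counter [some true] <| pushes .moves [some true] <| .goto fun _ => .target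
  | .clear => onPop .counter (.goto fun _ => .collect .moves) .halt fun _ => .goto fun _ => .clear
  | .collect k => .pop k (fun _ o => o) <| .branch (fun v => v.isSome)
      (.push .out (fun v => v.getD none) <| .goto fun _ => .collect k) (nextSection k)

/-- The reduction machine. -/
def reductionMachine : FinTM2 where
  K := Tape
  k₀ := .inp
  k₁ := .out
  Γ := fun _ => Option Bool
  Λ := Label
  main := .readVars
  σ := Option (Option Bool)
  initialState := none
  Γk₀Fin := inferInstanceAs (Fintype (Option Bool))
  m := reductionProg

abbrev reductionStep := TM2.step reductionProg

/-- The contents of all stacks. -/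
def tapes (inp counter spare sizes header states events moves out : List (Option Bool)) :
    Tape → List (Option Bool)
  | .inp => inp
  | .counter => counter
  | .spare => spare
  | .sizes => sizes
  | .header => header
  | .states => states
  | .events => events
  | .moves => moves
  | .out => out

/-- `n` times the symbol `b`. -/
def marks (b : Bool) (n : ℕ) : List (Option Bool) := List.replicate n (some b)

section Marks

variable (b : Bool) (n : ℕ) (l : List (Option Bool))

@[simp] theorem marks_zero : marks b 0 = [] := rfl

@[simp] theorem marks_succ : marks b (n + 1) = some b :: marks b n := rfl

-- Equal symbols commute; with this normal form `simp` identifies marks pushed one at a time with a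
-- block of marks.
@[simp] theorem marks_append_cons : marks b n ++ some b :: l = some b :: (marks b n ++ l) := by
  induction n with
  | zero => rfl
  | succ n ih => simp [ih]

@[simp] theorem reverse_marks : (marks b n).reverse = marks b n := List.reverse_replicate ..

@[simp] theorem length_marks : (marks b n).length = n := List.length_replicate ..

theorem marks_add (m : ℕ) : marks b (m + n) = marks b m ++ marks b n := List.replicate_add ..

end Marks

/-! ### Runs of the reduction machine, loop by loop -/

section Steps

variable (inp counter spare sizes header states events moves out l : List (Option Bool))

theorem update_tapes (k : Tape) :
    Function.update (tapes inp counter spare sizes header states events moves out) k l =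
      match k with
      | .inp => tapes l counter spare sizes header states events moves out
      | .counter => tapes inp l spare sizes header states events moves out
      | .spare => tapes inp counter l sizes header states events moves out
      | .sizes => tapes inp counter spare l header states events moves out
      | .header => tapes inp counter spare sizes l states events moves out
      | .states => tapes inp counter spare sizes header l events moves out
      | .events => tapes inp counter spare sizes header states l moves out
      | .moves => tapes inp counter spare sizes header states events l out
      | .out => tapes inp counter spare sizes header states events moves l := by
  funext k'
  cases k <;> cases k' <;> rfl

/-- One step of the machine executes a statement up to the next jump, so a block of pushes costs no
step of its own. -/
theorem stepAux_pushes (k : Tape) (q : Command) (v : Option (Option Bool))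
    (S : Tape → List (Option Bool)) :
    TM2.stepAux (pushes k l q) v S = TM2.stepAux q v (Function.update S k (l.reverse ++ S k)) := by
  induction l generalizing S with
  | nil => simp [pushes]
  | cons a l ih =>
    refine (ih _).trans ?_
    simp

theorem stepAux_onPop (k : Tape) (empty marker : Command) (bit : Bool → Command)
    (v : Option (Option Bool)) (S : Tape → List (Option Bool)) :
    TM2.stepAux (onPop k empty marker bit) v S = match S k with
      | [] => TM2.stepAux empty none S
      | none :: s => TM2.stepAux marker (some none) (Function.update S k s)
      | some b :: s => TM2.stepAux (bit b) (some (some b)) (Function.update S k s) := by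
  rcases h : S k with _ | ⟨_ | _ | _, s⟩
  · simp only [onPop, TM2.stepAux, h, List.head?_nil, List.tail_nil]
    rw [← h, Function.update_eq_self]
    rfl
  all_goals simp [onPop, h]

/-- A run of `n` steps between configurations that are not final. -/
abbrev Run (n : ℕ) (c : Label) (v : Option (Option Bool)) (S : Tape → List (Option Bool))
    (c' : Label) (v' : Option (Option Bool)) (S' : Tape → List (Option Bool)) : Prop :=
  ReachesIn reductionStep n ⟨some c, v, S⟩ ⟨some c', v', S'⟩

variable {inp counter spare sizes header states events moves out}

/-- Two marks per variable give the number 2n of protectable events; the closing symbols add the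
single unprotectable event. -/
theorem run_readVars (n : ℕ) (v : Option (Option Bool)) :
    Run (n + 1)
      .readVars v (tapes (marks true n ++ none :: inp) counter spare sizes
        header states events moves out)
      .tautology (some none) (tapes inp (marks true n ++ counter) spare sizes
        ((marks true (2 * n) ++ [none, some true, none]).reverse ++ header)
        states events moves out) := by
  induction n generalizing counter header v with
  | zero => exact ReachesIn.single (congrArg some (by
      simp [reductionProg, stepAux_onPop, stepAux_pushes, update_tapes, tapes]))
  | succ n ih =>
    refine ReachesIn.head rfl ?_
    simpa [reductionProg, stepAux_onPop, stepAux_pushes, update_tapes, tapes, mul_add] using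
      ih (counter := some true :: counter) (header := some true :: some true :: header)
        (some (some true))

/-- The counter is needed twice for each variable, once per literal. This loop empties it onto the
spare stack and `run_tautologyPos` restores it; both also write the exponent of a cost as zeros. -/
theorem run_tautologyNeg (n : ℕ) (v : Option (Option Bool)) :
    Run (n + 1)
      .tautologyNeg v (tapes inp (marks true n) spare sizes header states events moves out)
      .tautologyPos none (tapes (none :: some true :: (marks true n ++ inp)) []
        (marks true n ++ spare) sizes header states
        ((marks false n ++ [some true, none, some true, none, some true, none]).reverse ++ events)
        moves out) := by
  induction n generalizing inp spare events v with
  | zero => exact ReachesIn.single (congrArg some (by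
      simp [reductionProg, stepAux_onPop, stepAux_pushes, update_tapes, tapes]))
  | succ n ih =>
    refine ReachesIn.head rfl ?_
    simpa [reductionProg, stepAux_onPop, stepAux_pushes, update_tapes, tapes] using
      ih (inp := some true :: inp) (spare := some true :: spare) (events := some false :: events)
        (some (some true))

theorem run_tautologyPos (n : ℕ) (v : Option (Option Bool)) :
    Run (n + 1)
      .tautologyPos v (tapes inp counter (marks true n) sizes header states events moves out)
      .tautology none (tapes (some false :: (marks true n ++ inp)) (marks true n ++ counter)
        [] sizes header states
        ((marks false n ++ [some true, none, some true, none]).reverse ++ events)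
        moves out) := by
  induction n generalizing inp counter events v with
  | zero => exact ReachesIn.single (congrArg some (by
      simp [reductionProg, stepAux_onPop, stepAux_pushes, update_tapes, tapes]))
  | succ n ih =>
    refine ReachesIn.head rfl ?_
    simpa [reductionProg, stepAux_onPop, stepAux_pushes, update_tapes, tapes] using
      ih (inp := some true :: inp) (counter := some true :: counter)
        (events := some false :: events) (some (some true))

/-- The clauses `¬ xᵢ ∨ xᵢ` for `i < n`. -/
def tautologyCode : ℕ → List (Option Bool)
  | 0 => []
  | n + 1 => tautologyCode n ++
      (some false :: (marks true n ++ none :: some true :: (marks true n ++ [none, none])))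

/-- The data of the `2 * n` protectable events. -/
def eventCode : ℕ → List (Option Bool)
  | 0 => []
  | n + 1 => [some true, none] ++ marks false n ++ [some true, none, some true, none] ++
      ([some true, none] ++ marks false n ++ [some true, none, some true, none]) ++ eventCode n

/-- Variables are treated from the last to the first, so that the clause of variable 0 ends on top
of the input. Each round adds one binary digit 1 to the budget. -/
theorem run_tautology (n : ℕ) (v : Option (Option Bool)) :
    ∃ t ≤ n * (2 * n + 3) + 1, Run t
      .tautology v (tapes inp (marks true n) [] sizes header states events moves out)
      .word none (tapes (tautologyCode n ++ inp) [some true] []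
        ([some true, some true] ++ sizes)
        ((marks true n ++ [none]).reverse ++ header)
        ([some true, some false, none, some true, none].reverse ++ states)
        ((eventCode n).reverse ++ events)
        ([none, some false, none, some true, none].reverse ++ moves) out) := by
  induction n generalizing inp header events v with
  | zero => exact ⟨1, by simp, ReachesIn.single (congrArg some (by
      simp [reductionProg, stepAux_onPop, stepAux_pushes, update_tapes, tapes, tautologyCode,
        eventCode]))⟩
  | succ n ih =>
    have h₁ := run_tautologyNeg (inp := none :: none :: inp) (spare := []) (sizes := sizes)
      (header := some true :: header) (states := states) (events := none :: some true :: events)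
      (moves := moves) (out := out) n (some (some true))
    rw [List.append_nil] at h₁
    have h₂ := h₁.trans (run_tautologyPos n none)
    rw [List.append_nil] at h₂
    obtain ⟨t, ht, h₃⟩ := ih (header := some true :: header) none
    refine ⟨n + 1 + (n + 1) + t + 1, by nlinarith, ReachesIn.head rfl ?_⟩
    simpa [reductionProg, stepAux_onPop, stepAux_pushes, update_tapes, tapes, tautologyCode,
      eventCode] using h₂.trans h₃

theorem run_literal (s : Bool) (n : ℕ) (v : Option (Option Bool)) :
    Run (n + 1)
      (.literal s) v (tapes inp (marks true n) spare sizes header states events moves out)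
      .variable none (tapes inp [] (marks true n ++ spare) sizes header states events
        ((marks true n ++ none :: some true :: marks true s.toNat).reverse ++ moves) out) := by
  induction n generalizing spare moves v with
  | zero => exact ReachesIn.single (congrArg some (by
      cases s <;> simp [reductionProg, stepAux_onPop, stepAux_pushes, update_tapes, tapes, marks]))
  | succ n ih =>
    refine ReachesIn.head rfl ?_
    simpa [reductionProg, stepAux_onPop, stepAux_pushes, update_tapes, tapes] using
      ih (spare := some true :: spare) (moves := some true :: moves) (some (some true))

theorem run_variable (n : ℕ) (v : Option (Option Bool)) :
    Run (n + 1)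
      .variable v (tapes (marks true n ++ none :: inp) counter spare sizes header states events
        moves out)
      .target (some none) (tapes inp counter (some true :: spare) sizes header states events
        ((marks true (2 * n) ++ [none]).reverse ++ moves) out) := by
  induction n generalizing moves v with
  | zero => exact ReachesIn.single (congrArg some (by
      simp [reductionProg, stepAux_onPop, stepAux_pushes, update_tapes, tapes]))
  | succ n ih =>
    refine ReachesIn.head rfl ?_
    simpa [reductionProg, stepAux_onPop, stepAux_pushes, update_tapes, tapes, mul_add] using
      ih (moves := some true :: some true :: moves) (some (some true))

theorem run_clauseEnd (n : ℕ) (v : Option (Option Bool)) :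
    Run (n + 1)
      .clauseEnd v (tapes inp (marks true n) spare sizes header states events moves out)
      .target none (tapes inp [] (marks true (n + 1) ++ spare) sizes header states events
        moves out) := by
  induction n generalizing spare v with
  | zero => exact ReachesIn.single (congrArg some (by
      simp [reductionProg, stepAux_onPop, stepAux_pushes, update_tapes, tapes]))
  | succ n ih =>
    refine ReachesIn.head rfl ?_
    simpa [reductionProg, stepAux_onPop, stepAux_pushes, update_tapes, tapes] using
      ih (spare := some true :: spare) (some (some true))

theorem run_target (n : ℕ) (v : Option (Option Bool)) :
    Run (n + 1)
      .target v (tapes inp counter (marks true n) sizes header states events moves out)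
      .word none (tapes inp (marks true n ++ counter) [] sizes header states events
        ((marks true n ++ [none]).reverse ++ moves) out) := by
  induction n generalizing counter moves v with
  | zero => exact ReachesIn.single (congrArg some (by
      simp [reductionProg, stepAux_onPop, stepAux_pushes, update_tapes, tapes]))
  | succ n ih =>
    refine ReachesIn.head rfl ?_
    simpa [reductionProg, stepAux_onPop, stepAux_pushes, update_tapes, tapes] using
      ih (counter := some true :: counter) (moves := some true :: moves) (some (some true))

/-- The words of a formula: a literal, or (`none`) the end of a clause. -/
abbrev Token : Type := Option (ℕ × Bool)

def Token.code : Token → List (Option Bool)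
  | none => [none]
  | some (i, s) => some s :: (marks true i ++ [none])

/-- The data of the state in front of a token: it is secret in front of the end of a clause. -/
def Token.stateCode (t : Token) : List (Option Bool) :=
  [some false, some t.isNone, none, some true, none]

/-- The transition that belongs to the token at position `j` (counted from one): a literal is read
on the way to the next position, and the next clause is entered from the initial state. -/
def Token.moveCode (j : ℕ) : Token → List (Option Bool)
  | none => [none, some false, none] ++ (marks true (j + 1) ++ [none])
  | some (i, s) => (marks true j ++ none :: some true :: marks true s.toNat) ++
      (marks true (2 * i) ++ [none]) ++ (marks true (j + 1) ++ [none])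

def moveCodes : ℕ → List Token → List (Option Bool)
  | _, [] => []
  | j, t :: T => t.moveCode j ++ moveCodes (j + 1) T

theorem run_token (t : Token) (j N : ℕ) (ht : ∀ l ∈ t, l.1 ≤ N) (v : Option (Option Bool)) :
    ∃ n ≤ 2 * j + N + 5, Run n
      .word v (tapes (t.code ++ inp) (marks true j) [] sizes header states events moves out)
      .word none (tapes inp (marks true (j + 1)) [] (some true :: sizes) header
        (t.stateCode.reverse ++ states) events ((t.moveCode j).reverse ++ moves) out) := by
  rcases t with _ | ⟨i, s⟩
  · have h := (run_clauseEnd (inp := inp) (spare := []) (sizes := some true :: sizes)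
      (header := header) (states := (Token.stateCode none).reverse ++ states) (events := events)
      (moves := none :: some false :: none :: moves) (out := out) j (some none)).trans
      (by rw [List.append_nil]; exact run_target (j + 1) none)
    refine ⟨(j + 1 + (j + 1 + 1)) + 1, by omega, ReachesIn.head rfl ?_⟩
    simpa [reductionProg, stepAux_onPop, stepAux_pushes, update_tapes, tapes, Token.code,
      Token.stateCode, Token.moveCode] using h
  · have hi : i ≤ N := ht (i, s) rfl
    have h := (run_literal (inp := marks true i ++ none :: inp) (spare := [])
      (sizes := some true :: sizes) (header := header)
      (states := (Token.stateCode (some (i, s))).reverse ++ states) (events := events)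
      (moves := moves) (out := out) s j (some (some s))).trans
      ((run_variable i none).trans (by
        rw [List.append_nil, ← marks_succ]; exact run_target (j + 1) (some none)))
    refine ⟨(j + 1 + (i + 1 + (j + 1 + 1))) + 1, by omega, ReachesIn.head rfl ?_⟩
    simpa [reductionProg, stepAux_onPop, stepAux_pushes, update_tapes, tapes, Token.code,
      Token.stateCode, Token.moveCode] using h

/-- Invariant: the counter holds the number of the state in front of the next token and the spare
stack is empty. A token costs time linear in its position and variable index, whence a quadratic
bound in the number of tokens for fixed `N`. -/
theorem run_tokens (T : List Token) (j N : ℕ) (hT : ∀ t ∈ T, ∀ l ∈ t, l.1 ≤ N)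
    (v : Option (Option Bool)) :
    ∃ n ≤ T.length * (2 * (j + T.length) + N + 5), ∃ v', Run n
      .word v (tapes (T.flatMap Token.code ++ inp) (marks true j) [] sizes header states events
        moves out)
      .word v' (tapes inp (marks true (j + T.length)) [] (marks true T.length ++ sizes) header
        ((T.flatMap Token.stateCode).reverse ++ states) events
        ((moveCodes j T).reverse ++ moves) out) := by
  induction T generalizing j sizes states moves v with
  | nil => exact ⟨0, by simp, v, ReachesIn.refl _ _⟩
  | cons t T ih =>
    obtain ⟨n, hn, h⟩ := run_token (inp := T.flatMap Token.code ++ inp) (sizes := sizes)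
      (header := header) (states := states) (events := events) (moves := moves) (out := out)
      t j N (hT t (by simp)) v
    obtain ⟨n', hn', v', h'⟩ := ih (sizes := some true :: sizes)
      (states := t.stateCode.reverse ++ states) (moves := (t.moveCode j).reverse ++ moves)
      (j + 1) (fun t ht => hT t (by simp [ht])) none
    refine ⟨n + n', ?_, v', ?_⟩
    · rw [List.length_cons]
      nlinarith
    · have := h.trans h'
      simpa [moveCodes, add_assoc, add_comm 1] using this

theorem run_word_nil (v : Option (Option Bool)) :
    Run 1
      .word v (tapes [] counter spare sizes header states events moves out)
      .clear none (tapes [] counter spare (none :: sizes) header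
        ([some false, some false, none, some true, none].reverse ++ states) events moves out) :=
  ReachesIn.single (congrArg some (by
    simp [reductionProg, stepAux_onPop, stepAux_pushes, update_tapes, tapes]))

theorem run_clear (n : ℕ) (v : Option (Option Bool)) :
    Run (n + 1)
      .clear v (tapes inp (marks true n) spare sizes header states events moves out)
      (.collect .moves) none (tapes inp [] spare sizes header states events moves out) := by
  induction n generalizing v with
  | zero => exact ReachesIn.single (congrArg some (by
      simp [reductionProg, stepAux_onPop, tapes]))
  | succ n ih =>
    refine ReachesIn.head rfl ?_
    simpa [reductionProg, stepAux_onPop, update_tapes, tapes] using ih (some (some true))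

theorem reachesIn_collect (k : Tape) (hk : k ≠ .out) (l : List (Option Bool))
    (S : Tape → List (Option Bool)) (hS : S k = l) (v : Option (Option Bool)) :
    ReachesIn reductionStep (l.length + 1) ⟨some (.collect k), v, S⟩
      (TM2.stepAux (nextSection k) none
        (Function.update (Function.update S k []) .out (l.reverse ++ S .out))) := by
  induction l generalizing S v with
  | nil =>
    refine ReachesIn.single (congrArg some ?_)
    have h : Function.update S k [] = S := by rw [← hS, Function.update_eq_self]
    simp [reductionProg, hS, h]
  | cons a l ih =>
    refine ReachesIn.head rfl ?_
    have := ih (Function.update (Function.update S k l) .out (a :: S .out)) (by simp [hk]) (some a)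
    rw [Function.update_comm hk.symm, Function.update_idem, Function.update_idem] at this
    simpa [reductionProg, hS, hk.symm] using this

/-- Each section is stored with its last symbol on top, and the output stack is filled from the
bottom, so the sections are unloaded from the last to the first. -/
theorem reachesIn_collect_all (v : Option (Option Bool)) :
    ReachesIn reductionStep
      ((moves.length + 1) + (events.length + 1) + (states.length + 1) + (header.length + 1) +
        (sizes.length + 1))
      ⟨some (.collect .moves), v, tapes [] [] [] sizes header states events moves []⟩
      ⟨none, none, tapes [] [] [] [] [] [] [] []
        (sizes.reverse ++ header.reverse ++ states.reverse ++ events.reverse ++ moves.reverse)⟩ := by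
  have h₁ := reachesIn_collect .moves (by simp) moves
    (tapes [] [] [] sizes header states events moves []) rfl v
  have h₂ := reachesIn_collect .events (by simp) events
    (tapes [] [] [] sizes header states events [] moves.reverse) rfl none
  have h₃ := reachesIn_collect .states (by simp) states
    (tapes [] [] [] sizes header states [] [] (events.reverse ++ moves.reverse)) rfl none
  have h₄ := reachesIn_collect .header (by simp) header
    (tapes [] [] [] sizes header [] [] [] (states.reverse ++ (events.reverse ++ moves.reverse)))
    rfl none
  have h₅ := reachesIn_collect .sizes (by simp) sizes
    (tapes [] [] [] sizes [] [] [] [] (header.reverse ++ (states.reverse ++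
      (events.reverse ++ moves.reverse)))) rfl none
  simp only [update_tapes, nextSection, TM2.stepAux, tapes, List.append_nil] at h₁ h₂ h₃ h₄ h₅
  simpa only [List.append_assoc] using (((h₁.trans h₂).trans h₃).trans h₄).trans h₅

end Steps

/-- The output of the reduction machine for a formula over `n` variables, where `T` are the tokens
of the formula together with the tautologies. -/
def outputCode (n : ℕ) (T : List Token) : List (Option Bool) :=
  (marks true (T.length + 2) ++ [none]) ++
  (marks true (2 * n) ++ [none, some true, none] ++ (marks true n ++ [none])) ++
  ([some true, some false, none, some true, none] ++ T.flatMap Token.stateCode ++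
    [some false, some false, none, some true, none]) ++
  eventCode n ++
  ([none, some false, none, some true, none] ++ moveCodes 1 T)

theorem reductionMachine_outputs (n : ℕ) (inp : List (Option Bool)) (T : List Token)
    (hT : ∀ t ∈ T, ∀ l ∈ t, l.1 ≤ n) (hinp : tautologyCode n ++ inp = T.flatMap Token.code) :
    Nonempty (TM2OutputsInTime reductionMachine (marks true n ++ none :: inp)
      (some (outputCode n T))
      (n * (2 * n + 4) + T.length * (2 * T.length + n + 7) + T.length + 10 +
        (outputCode n T).length)) := by
  have h₁ := run_readVars (inp := inp) (counter := []) (spare := []) (sizes := []) (header := [])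
    (states := []) (events := []) (moves := []) (out := []) n none
  obtain ⟨t₂, ht₂, h₂⟩ := run_tautology (inp := inp) (sizes := [])
    (header := (marks true (2 * n) ++ [none, some true, none]).reverse ++ [])
    (states := []) (events := []) (moves := []) (out := []) n (some none)
  obtain ⟨t₃, ht₃, v, h₃⟩ := run_tokens (inp := []) (sizes := [some true, some true] ++ [])
    (header := (marks true n ++ [none]).reverse ++
      ((marks true (2 * n) ++ [none, some true, none]).reverse ++ []))
    (states := [some true, some false, none, some true, none].reverse ++ [])
    (events := (eventCode n).reverse ++ [])
    (moves := [none, some false, none, some true, none].reverse ++ []) (out := []) T 1 n hT none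
  rw [List.append_nil, ← hinp] at h₃
  rw [List.append_nil] at h₁
  have h₆ := (((h₁.trans h₂).trans h₃).trans (run_word_nil v)).trans
    ((run_clear (1 + T.length) none).trans (reachesIn_collect_all none))
  have hi := initList_eq reductionMachine (marks true n ++ none :: inp)
  have ho := haltList_eq reductionMachine (outputCode n T)
  have ei : tapes (marks true n ++ none :: inp) [] [] [] [] [] [] [] [] =
      Function.update (fun _ => []) Tape.inp (marks true n ++ none :: inp) := by
    funext k; cases k <;> rfl
  have eo : ∀ l, tapes [] [] [] [] [] [] [] [] l = Function.update (fun _ => []) Tape.out l := by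
    intro l; funext k; cases k <;> rfl
  rw [ei, eo] at h₆
  refine ⟨⟨⟨_, (congrArg (fun c => _^[_] (some c)) hi).trans (Eq.trans h₆ ?_)⟩, ?_⟩⟩
  · refine Eq.trans ?_ (congrArg some ho).symm
    refine congrArg (fun l => some (⟨none, none, Function.update (fun _ => []) Tape.out l⟩ :
      TM2.Cfg (fun _ : Tape => Option Bool) Label (Option (Option Bool)))) ?_
    simp [outputCode]
  · simp [outputCode]
    nlinarith

/-! ### The system of a list of clauses -/

/-- The elements of the lists, with `none` after each list. -/
def tokens {α : Type} (cs : List (List α)) : List (Option α) :=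
  cs.flatMap fun C => C.map some ++ [none]

/-- The elements after the last `none`. -/
def pending {α : Type} (T : List (Option α)) : List α :=
  T.foldl (fun acc t => t.elim [] fun a => acc ++ [a]) []

section Tokens

variable {α : Type}

@[simp] theorem tokens_nil : tokens ([] : List (List α)) = [] := rfl

@[simp] theorem tokens_cons (C : List α) (cs : List (List α)) :
    tokens (C :: cs) = C.map some ++ none :: tokens cs := by simp [tokens]

theorem tokens_append (cs cs' : List (List α)) : tokens (cs ++ cs') = tokens cs ++ tokens cs' :=
  List.flatMap_append

theorem pending_concat_some (T : List (Option α)) (a : α) :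
    pending (T ++ [some a]) = pending T ++ [a] := by simp [pending]

theorem pending_append_none (T T' : List (Option α)) : pending (T ++ none :: T') = pending T' := by
  simp [pending]

theorem pending_map_some (C : List α) : pending (C.map some) = C := by
  induction C using List.reverseRecOn with
  | nil => rfl
  | append_singleton C a ih => rw [List.map_append, List.map_singleton, pending_concat_some, ih]

/-- A clause is complete exactly at the `none` that ends it, and what precedes the previous `none`
has been forgotten by then. -/
theorem mem_iff_pending_tokens (cs : List (List α)) (C : List α) :
    C ∈ cs ↔ ∃ j, (tokens cs)[j]? = some none ∧ pending ((tokens cs).take j) = C := by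
  induction cs with
  | nil => simp
  | cons D cs ih =>
    rw [List.mem_cons, ih, tokens_cons]
    constructor
    · rintro (rfl | ⟨j, hj, h⟩)
      · exact ⟨C.length, by simp, by simp [pending_map_some]⟩
      · refine ⟨D.length + (j + 1), ?_, ?_⟩
        · simp [List.getElem?_append, hj]
        · rw [List.take_append]
          simp [pending_append_none, h, List.take_of_length_le]
    · rintro ⟨j, hj, h⟩
      -- Inside `D` there is no end marker; at its end the pending list is `D`; beyond it the
      -- positions are those of `cs`, shifted by `D.length + 1`.
      rcases lt_trichotomy j D.length with hlt | rfl | hlt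
      · simp [List.getElem?_append, hlt] at hj
      · left
        simpa [pending_map_some] using h.symm
      · obtain ⟨k, rfl⟩ := Nat.exists_eq_add_of_lt hlt
        rw [add_assoc] at hj h
        refine Or.inr ⟨k, ?_, ?_⟩
        · simpa [List.getElem?_append] using hj
        · rw [List.take_append] at h
          simpa [pending_append_none, List.take_of_length_le] using h

end Tokens

/-- The protectable event of a literal. -/
def literalEvent {n : ℕ} (l : Fin n × Bool) : Fin (2 * n) :=
  ⟨2 * l.1 + l.2.toNat, by have := l.1.2; have := l.2.toNat_le; omega⟩

theorem literalEvent_injective {n : ℕ} : Function.Injective (literalEvent (n := n)) := by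
  rintro ⟨i, s⟩ ⟨j, t⟩ h
  have h := congrArg Fin.val h
  simp only [literalEvent] at h
  have h₁ : (i : ℕ) = j := by have := s.toNat_le; have := t.toNat_le; omega
  have h₂ : s = t := by cases s <;> cases t <;> simp at h ⊢ <;> omega
  exact Prod.ext (Fin.ext h₁) h₂

/-- The transition that belongs to the token at position `j`. -/
def tokenTransition {n m : ℕ} (j : Fin m) :
    Option (Fin n × Bool) → Fin (m + 2) × (Fin (2 * n) ⊕ Fin 1) × Fin (m + 2)
  | none => (0, .inr 0, j.succ.succ)
  | some l => (j.castSucc.succ, .inl (literalEvent l), j.succ.succ)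

/-- The instance in which each clause is spelled out on the way to a secret state, and in which the
two literals of a variable have the same power of two as their cost. -/
def clauseInstance (n : ℕ) (cs : List (List (Fin n × Bool))) : Instance where
  numStates := (tokens cs).length + 2
  numProt := 2 * n
  numUnprot := 1
  alphabet_nonempty := by omega
  isInitial := Fin.cases true fun _ => false
  isSecret := Fin.cases false fun j => (tokens cs)[j.1]?.any Option.isNone
  disjoint q hq := by cases q using Fin.cases <;> simp_all
  level _ := 1
  clearance _ := 1
  -- Halving the event index gives the variable, so both literals have the same cost.
  cost a := 2 ^ (n - 1 - a / 2)
  transitions := (0, .inr 0, 1) ::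
    List.ofFn fun j : Fin (tokens cs).length => tokenTransition j (tokens cs)[j]
  budget := 2 ^ n - 1

/-- The automaton of `clauseInstance`. -/
def clauseAut (n : ℕ) (cs : List (List (Fin n × Bool))) :
    NFA (Fin (2 * n) ⊕ Fin 1) (Fin ((tokens cs).length + 2)) :=
  (clauseInstance n cs).system.aut

/-! ### The language of the automaton and its valid policies -/

section ClauseInstance

variable {n : ℕ} {cs : List (List (Fin n × Bool))}

/-- The only word that leads to the state in front of the token at position `j`. -/
def positionWord (cs : List (List (Fin n × Bool))) (j : ℕ) : List (Fin (2 * n) ⊕ Fin 1) :=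
  .inr 0 :: (pending ((tokens cs).take j)).map fun l => .inl (literalEvent l)

theorem positionWord_succ_none {j : ℕ} (h : (tokens cs)[j]? = some none) :
    positionWord cs (j + 1) = [.inr 0] := by
  simp [positionWord, List.take_add_one, h, pending]

theorem positionWord_succ_some {j : ℕ} {l : Fin n × Bool} (h : (tokens cs)[j]? = some (some l)) :
    positionWord cs (j + 1) = positionWord cs j ++ [.inl (literalEvent l)] := by
  simp [positionWord, List.take_add_one, h, pending_concat_some]

theorem mem_step_clauseAut (q q' : Fin ((tokens cs).length + 2)) (a : Fin (2 * n) ⊕ Fin 1) :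
    q' ∈ (clauseAut n cs).step q a ↔
      (q = 0 ∧ a = .inr 0 ∧ q' = 1) ∨
      ∃ j : Fin (tokens cs).length, tokenTransition j (tokens cs)[j] = (q, a, q') := by
  change (q, a, q') ∈ (0, Sum.inr 0, 1) ::
    List.ofFn (fun j : Fin (tokens cs).length => tokenTransition j (tokens cs)[j]) ↔ _
  rw [List.mem_cons, List.mem_ofFn, Prod.mk.injEq, Prod.mk.injEq]

/-- Every state except 0 has exactly one way in: state 1 and the first state of a new clause come
from 0, any other from its predecessor by a literal. The automaton is thus a tree, and each state is
reached by exactly one word. -/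
theorem mem_eval_clauseAut (w : List (Fin (2 * n) ⊕ Fin 1))
    (q : Fin ((tokens cs).length + 2)) :
    q ∈ (clauseAut n cs).eval w ↔
      (q = 0 ∧ w = []) ∨ ∃ j, q.1 = j + 1 ∧ w = positionWord cs j := by
  constructor
  · induction w using List.reverseRecOn generalizing q with
    | nil =>
      intro h
      left
      refine ⟨?_, rfl⟩
      have h : (clauseInstance n cs).isInitial q = true := h
      cases q using Fin.cases with
      | zero => rfl
      | succ q => simp [clauseInstance] at h
    | append_singleton w a ih =>
      rw [NFA.eval_append_singleton, NFA.mem_stepSet]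
      rintro ⟨p, hp, hq⟩
      right
      have ih := ih p hp
      rcases (mem_step_clauseAut p q a).1 hq with ⟨rfl, rfl, rfl⟩ | ⟨j, hj⟩
      · obtain ⟨-, rfl⟩ | ⟨j, hj, -⟩ := ih
        · exact ⟨0, rfl, by simp [positionWord, pending]⟩
        · simp at hj
      · rcases ht : (tokens cs)[j] with _ | l
        · rw [ht] at hj
          obtain ⟨rfl, rfl, rfl⟩ : 0 = p ∧ .inr 0 = a ∧ j.succ.succ = q := by
            simpa [tokenTransition] using hj
          obtain ⟨-, rfl⟩ | ⟨i, hi, -⟩ := ih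
          · refine ⟨j + 1, by simp, ?_⟩
            rw [positionWord_succ_none (by simpa using ht)]
            rfl
          · simp at hi
        · rw [ht] at hj
          obtain ⟨rfl, rfl, rfl⟩ : j.castSucc.succ = p ∧ .inl (literalEvent l) = a ∧
              j.succ.succ = q := by
            simpa [tokenTransition] using hj
          obtain ⟨h, -⟩ | ⟨i, hi, rfl⟩ := ih
          · exact absurd h (Fin.succ_ne_zero _)
          · obtain rfl : j.1 = i := by simpa using hi
            exact ⟨j + 1, by simp, (positionWord_succ_some (by simpa using ht)).symm⟩
  · have hstart : (0 : Fin ((tokens cs).length + 2)) ∈ (clauseAut n cs).eval [] :=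
      show (clauseInstance n cs).isInitial (0 : Fin ((tokens cs).length + 2)) = true from rfl
    rintro (⟨rfl, rfl⟩ | ⟨j, hj, rfl⟩)
    · exact hstart
    · induction j generalizing q with
      | zero =>
        obtain rfl : q = 1 := Fin.ext (by simpa using hj)
        have : positionWord cs 0 = [] ++ [.inr 0] := by simp [positionWord, pending]
        rw [this, NFA.eval_append_singleton, NFA.mem_stepSet]
        exact ⟨0, hstart, (mem_step_clauseAut ..).2 (.inl ⟨rfl, rfl, rfl⟩)⟩
      | succ j ih =>
        have hlt : j < (tokens cs).length := by have := q.2; omega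
        obtain rfl : q = (Fin.mk j hlt).succ.succ := Fin.ext (by simpa using hj)
        rcases ht : (tokens cs)[j] with _ | l
        · have : positionWord cs (j + 1) = [] ++ [.inr 0] :=
            positionWord_succ_none (by simp [hlt, ht])
          rw [this, NFA.eval_append_singleton, NFA.mem_stepSet]
          exact ⟨0, hstart, (mem_step_clauseAut ..).2
            (.inr ⟨⟨j, hlt⟩, by simp [ht, tokenTransition]⟩)⟩
        · rw [positionWord_succ_some (l := l) (by simp [hlt, ht]), NFA.eval_append_singleton,
            NFA.mem_stepSet]
          exact ⟨(Fin.mk j hlt).castSucc.succ, ih _ rfl, (mem_step_clauseAut ..).2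
            (.inr ⟨⟨j, hlt⟩, by simp [ht, tokenTransition]⟩)⟩

/-- The secret states are those in front of an end marker, and the words leading there spell the
clauses, by `mem_iff_pending_tokens`. -/
theorem forall_secret_iff (p : List (Fin (2 * n) ⊕ Fin 1) → Prop) :
    (∀ (w : List (Fin (2 * n) ⊕ Fin 1)) (q : Fin ((tokens cs).length + 2)), q ∈ (clauseAut n cs).eval w →
      q ∈ (clauseAut n cs).accept → p w) ↔
    ∀ C ∈ cs, p (.inr 0 :: C.map fun l => .inl (literalEvent l)) := by
  have hsec : ∀ j (h : j + 1 < (tokens cs).length + 2),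
      (⟨j + 1, h⟩ : Fin ((tokens cs).length + 2)) ∈ (clauseAut n cs).accept ↔
        (tokens cs)[j]? = some none := by
    intro j h
    change ((tokens cs)[j]?.any Option.isNone) = true ↔ _
    cases (tokens cs)[j]? <;> simp
  constructor
  · intro h C hC
    obtain ⟨j, hj, rfl⟩ := (mem_iff_pending_tokens cs C).1 hC
    have hlt : j + 1 < (tokens cs).length + 2 := by
      have := (List.getElem?_eq_some_iff.1 hj).1
      omega
    exact h _ ⟨j + 1, hlt⟩ ((mem_eval_clauseAut ..).2 (.inr ⟨j, rfl, rfl⟩))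
      ((hsec j hlt).2 hj)
  · rintro h w q hw hq
    rcases (mem_eval_clauseAut ..).1 hw with ⟨rfl, -⟩ | ⟨j, hj, rfl⟩
    · exact absurd hq Bool.false_ne_true
    · have hq' : q = ⟨j + 1, hj ▸ q.2⟩ := Fin.ext hj
      exact h _ ((mem_iff_pending_tokens cs _).2 ⟨j, (hsec j _).1 (hq' ▸ hq), rfl⟩)

/-- With level and clearance one, only the occurrence of a protected event matters, not its
multiplicity; hence validity and χ-validity agree on these instances. -/
theorem one_le_sum_iff {E : Type} (P : Finset E) (f : E → ℕ) :
    1 ≤ ∑ a ∈ P, 1 * f a ↔ ∃ a ∈ P, f a ≠ 0 := by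
  simp [Nat.one_le_iff_ne_zero, Finset.sum_eq_zero_iff]

/-- The policy `P` protects a literal of each clause. -/
def Hits (cs : List (List (Fin n × Bool))) (P : Finset (Fin (2 * n))) : Prop :=
  ∀ C ∈ cs, ∃ l ∈ C, literalEvent l ∈ P

/-- Needed for `List.count_pos_iff` on words over the sum of the two kinds of events. -/
instance {α β : Type} [BEq α] [BEq β] [LawfulBEq α] [LawfulBEq β] : LawfulBEq (α ⊕ β) where
  rfl {a} := by
    cases a with
    | inl a => exact (beq_self_eq_true a : (a == a) = true)
    | inr a => exact (beq_self_eq_true a : (a == a) = true)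
  eq_of_beq {a b} h := by
    rcases a with a | a <;> rcases b with b | b
    · exact congrArg Sum.inl (eq_of_beq (a := a) (b := b) h)
    · exact absurd h Bool.false_ne_true
    · exact absurd h Bool.false_ne_true
    · exact congrArg Sum.inr (eq_of_beq (a := a) (b := b) h)

theorem exists_mem_clauseWord_iff (P : Finset (Fin (2 * n))) (C : List (Fin n × Bool)) :
    (∃ a ∈ P, Sum.inl a ∈ (Sum.inr 0 : Fin (2 * n) ⊕ Fin 1) ::
      C.map fun l => Sum.inl (literalEvent l)) ↔ ∃ l ∈ C, literalEvent l ∈ P := by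
  simp only [List.mem_cons, reduceCtorEq, List.mem_map, Sum.inl.injEq, false_or]
  constructor
  · rintro ⟨_, ha, l, hl, rfl⟩
    exact ⟨l, hl, ha⟩
  · rintro ⟨l, hl, h⟩
    exact ⟨_, h, l, hl, rfl⟩

theorem valid_clauseInstance_iff (P : Finset (Fin (2 * n))) :
    (clauseInstance n cs).system.Valid P ↔ Hits cs P := by
  refine (forall_secret_iff fun w => 1 ≤ ∑ a ∈ P, 1 * w.count (Sum.inl a)).trans ?_
  refine forall₂_congr fun C _ => (one_le_sum_iff P _).trans ?_
  rw [← exists_mem_clauseWord_iff]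
  exact exists_congr fun a => and_congr_right fun _ => Nat.pos_iff_ne_zero.symm.trans List.count_pos_iff

theorem chiValid_clauseInstance_iff (P : Finset (Fin (2 * n))) :
    (clauseInstance n cs).system.ChiValid P ↔ Hits cs P := by
  refine (forall_secret_iff fun w => 1 ≤ ∑ a ∈ P, 1 * chi w (Sum.inl a)).trans ?_
  refine forall₂_congr fun C _ => (one_le_sum_iff P _).trans ?_
  rw [← exists_mem_clauseWord_iff]
  refine exists_congr fun a => and_congr_right fun _ => ?_
  rw [chi]
  split_ifs with h <;> simp only [h, ne_eq, one_ne_zero, not_false_eq_true, not_true_eq_false]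

theorem policyCost_clauseInstance_le_iff (P : Finset (Fin (2 * n))) :
    (clauseInstance n cs).system.policyCost P ≤ ((clauseInstance n cs).budget : ℝ≥0) ↔
      ∑ a ∈ P, 2 ^ (n - 1 - (a : ℕ) / 2) ≤ 2 ^ n - 1 := by
  rw [← Nat.cast_le (α := ℝ≥0)]
  change ∑ a ∈ P, (((2 ^ (n - 1 - (a : ℕ) / 2) : ℚ≥0)) : ℝ≥0) ≤ ((2 ^ n - 1 : ℕ) : ℝ≥0) ↔ _
  push_cast
  rfl

end ClauseInstance

/-! ### Satisfiability and policies -/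

/-- For each variable the clause that contains it and its negation. -/
def tautologies (n : ℕ) : List (List (Fin n × Bool)) :=
  (List.finRange n).map fun i => [(i, false), (i, true)]

/-- The instance of a formula. -/
def CNF3.toInstance (φ : CNF3) : Instance :=
  clauseInstance φ.numVars (tautologies φ.numVars ++ φ.clauses)

theorem CNF3.toInstance_uniform (φ : CNF3) : φ.toInstance.Uniform := fun _ => rfl

/-- The policy that protects the true literals of an assignment. -/
def assignmentPolicy {n : ℕ} (v : Fin n → Bool) : Finset (Fin (2 * n)) :=
  Finset.univ.image fun i => literalEvent (i, v i)

theorem literalEvent_mem_assignmentPolicy {n : ℕ} (v : Fin n → Bool) (l : Fin n × Bool) :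
    literalEvent l ∈ assignmentPolicy v ↔ v l.1 = l.2 := by
  simp only [assignmentPolicy, Finset.mem_image, Finset.mem_univ, true_and]
  constructor
  · rintro ⟨i, hi⟩
    rw [← literalEvent_injective hi]
  · intro h
    exact ⟨l.1, by rw [h]⟩

/-- One literal per variable is chosen and its cost does not depend on the sign, so the sum is the
full geometric series. -/
theorem cost_assignmentPolicy {n : ℕ} (v : Fin n → Bool) :
    ∑ a ∈ assignmentPolicy v, 2 ^ (n - 1 - (a : ℕ) / 2) = 2 ^ n - 1 := by
  rw [assignmentPolicy, Finset.sum_image fun i _ j _ h => congrArg Prod.fst (literalEvent_injective h)]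
  have : ∀ i : Fin n, (literalEvent (i, v i) : ℕ) / 2 = i := fun i => by
    have := (v i).toNat_le
    simp only [literalEvent]
    omega
  simp only [this]
  rw [Fin.sum_univ_eq_sum_range (fun i => 2 ^ (n - 1 - i)),
    Finset.sum_range_reflect (fun i => 2 ^ i), Nat.geomSum_eq le_rfl]
  simp

theorem CNF3.satisfiable_iff (φ : CNF3) :
    φ.Satisfiable ↔ ∃ P : Finset (Fin (2 * φ.numVars)),
      Hits (tautologies φ.numVars ++ φ.clauses) P ∧
        ∑ a ∈ P, 2 ^ (φ.numVars - 1 - (a : ℕ) / 2) ≤ 2 ^ φ.numVars - 1 := by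
  constructor
  · rintro ⟨v, hv⟩
    refine ⟨assignmentPolicy v, fun C hC => ?_, (cost_assignmentPolicy v).le⟩
    simp only [literalEvent_mem_assignmentPolicy]
    rcases List.mem_append.1 hC with hC | hC
    · obtain ⟨i, -, rfl⟩ := List.mem_map.1 hC
      exact ⟨(i, v i), by cases v i <;> simp, rfl⟩
    · exact hv C hC
  · rintro ⟨P, hP, hc⟩
    have hs : ∀ i : Fin φ.numVars, ∃ s, literalEvent (i, s) ∈ P := fun i => by
      obtain ⟨l, hl, h⟩ := hP [(i, false), (i, true)] (by simp [tautologies])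
      rcases List.mem_pair.1 hl with rfl | rfl
      exacts [⟨_, h⟩, ⟨_, h⟩]
    choose v hv using hs
    have hsub : assignmentPolicy v ⊆ P := by
      intro a ha
      obtain ⟨i, -, rfl⟩ := Finset.mem_image.1 ha
      exact hv i
    -- The chosen literals already exhaust the budget and all costs are positive, so a further event
    -- would exceed it.
    have heq : assignmentPolicy v = P := by
      by_contra hne
      obtain ⟨a, haP, ha⟩ := Finset.exists_of_ssubset (hsub.ssubset_of_ne hne)
      have := Finset.sum_lt_sum_of_subset (f := fun a : Fin (2 * φ.numVars) =>
        2 ^ (φ.numVars - 1 - (a : ℕ) / 2)) hsub haP ha (by positivity) fun _ _ _ => by positivity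
      rw [cost_assignmentPolicy] at this
      omega
    refine ⟨v, fun C hC => ?_⟩
    obtain ⟨l, hl, h⟩ := hP C (by simp [hC])
    rw [← heq, literalEvent_mem_assignmentPolicy] at h
    exact ⟨l, hl, h⟩

theorem CNF3.hasValidPolicy_toInstance (φ : CNF3) :
    φ.toInstance.HasValidPolicy ↔ φ.Satisfiable := by
  rw [φ.satisfiable_iff]
  exact exists_congr fun P =>
    and_congr (valid_clauseInstance_iff P) (policyCost_clauseInstance_le_iff P)

theorem CNF3.hasChiValidPolicy_toInstance (φ : CNF3) :
    φ.toInstance.HasChiValidPolicy ↔ φ.Satisfiable := by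
  rw [φ.satisfiable_iff]
  exact exists_congr fun P =>
    and_congr (chiValid_clauseInstance_iff P) (policyCost_clauseInstance_le_iff P)

/-! ### The reduction machine computes the reduction -/

theorem encodeWords_cons (w : List Bool) (ws : List (List Bool)) :
    encodeWords (w :: ws) = w.map some ++ none :: encodeWords ws := by simp [encodeWords]

@[simp] theorem encodeWords_nil : encodeWords [] = [] := rfl

theorem encodeWords_append (ws ws' : List (List Bool)) :
    encodeWords (ws ++ ws') = encodeWords ws ++ encodeWords ws' := List.flatMap_append

theorem encodeWords_flatMap {α : Type} (l : List α) (f : α → List (List Bool)) :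
    encodeWords (l.flatMap f) = l.flatMap fun a => encodeWords (f a) := by
  simp [encodeWords, List.flatMap_assoc]

theorem map_some_unary (n : ℕ) : (unary n).map some = marks true n := List.map_replicate ..

theorem binary_two_pow (k : ℕ) : binary (2 ^ k) = List.replicate k false ++ [true] := by
  induction k with
  | zero => simp [binary]
  | succ k ih =>
    have : binary (2 ^ (k + 1)) = false :: binary (2 ^ k) := by
      rw [pow_succ']
      exact Nat.bit0_bits _ (by positivity)
    rw [this, ih]
    rfl

/-- This lets the machine write the budget with one mark per variable. -/
theorem binary_two_pow_sub_one (k : ℕ) : binary (2 ^ k - 1) = unary k := by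
  induction k with
  | zero => simp [binary, unary]
  | succ k ih =>
    have h : 2 ^ (k + 1) - 1 = 2 * (2 ^ k - 1) + 1 := by
      have := Nat.one_le_two_pow (n := k)
      rw [pow_succ']
      omega
    have : binary (2 ^ (k + 1) - 1) = true :: binary (2 ^ k - 1) := by
      rw [h]
      exact Nat.bit1_bits _
    rw [this, ih]
    rfl

/-- A literal over the first `n` variables as a token. -/
def toToken {n : ℕ} (t : Option (Fin n × Bool)) : Token := t.map fun l => (l.1.1, l.2)

theorem encode_eq (φ : CNF3) :
    φ.encode = marks true φ.numVars ++
      none :: ((tokens φ.clauses).map toToken).flatMap Token.code := by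
  rw [CNF3.encode, CNF3.words, encodeWords_cons, map_some_unary, encodeWords_flatMap, tokens]
  congr 2
  rw [List.map_flatMap, List.flatMap_assoc]
  congr 1
  funext C
  rw [encodeWords_append]
  simp only [encodeWords, List.flatMap_map, List.map_append, List.flatMap_append, List.map_map]
  congr 1
  congr 1
  funext l
  simp [← map_some_unary, toToken, Token.code]

theorem tautologyCode_eq (n : ℕ) :
    tautologyCode n = ((tokens (tautologies n)).map toToken).flatMap Token.code := by
  have key : ∀ n, tautologyCode n = (List.range n).flatMap fun i =>
      some false :: (marks true i ++ none :: some true :: (marks true i ++ [none, none])) := by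
    intro n
    induction n with
    | zero => rfl
    | succ n ih => rw [List.range_succ, List.flatMap_append, ← ih]; simp [tautologyCode]
  rw [key, tokens, tautologies, ← List.map_coe_finRange_eq_range]
  simp [List.flatMap_map, List.map_flatMap, List.flatMap_assoc, toToken, Token.code,
    -List.map_coe_finRange_eq_range, -marks_append_cons]

/-- The machine writes the events in increasing order while its counter runs down, which is why the
exponent of variable i is n - 1 - i. -/
theorem eventCode_eq (n : ℕ) :
    eventCode n = (List.range (2 * n)).flatMap fun a =>
      [some true, none] ++ marks false (n - 1 - a / 2) ++ [some true, none, some true, none] := by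
  induction n with
  | zero => rfl
  | succ n ih =>
    rw [eventCode, ih, mul_add, mul_one, add_comm (2 * n) 2, List.range_add]
    have : List.range 2 = [0, 1] := rfl
    rw [List.flatMap_append, this, List.flatMap_map]
    congr 1
    · simp
    · refine congrArg (fun f => List.flatMap f (List.range (2 * n))) (funext fun a => ?_)
      have : n - 1 - a / 2 = n + 1 - 1 - (2 + a) / 2 := by omega
      rw [this]

theorem flatMap_finRange_succ {β : Type} {m : ℕ} (f : Fin (m + 1) → List β) :
    (List.finRange (m + 1)).flatMap f = f 0 ++ (List.finRange m).flatMap fun j => f j.succ := by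
  rw [List.finRange_succ, List.flatMap_cons, List.flatMap_map]

theorem flatMap_finRange_getElem? {α β : Type} (T : List α) (f : Option α → List β) :
    (List.finRange (T.length + 1)).flatMap (fun j => f T[j.1]?) =
      T.flatMap (fun t => f (some t)) ++ f none := by
  induction T with
  | nil => simp [List.finRange_succ]
  | cons t T ih =>
    rw [List.length_cons, flatMap_finRange_succ]
    simpa using ih

theorem flatMap_ofFn_moveCode (T : List Token) (k : ℕ) :
    (List.ofFn fun j : Fin T.length => T[j].moveCode (k + j)).flatten = moveCodes k T := by
  induction T generalizing k with
  | nil => rfl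
  | cons t T ih =>
    rw [moveCodes, ← ih]
    simp [List.ofFn_succ, add_assoc, add_comm 1]

/-- Positions in the token list start at 0 but the machine's counter starts at 1, since state 0 is
reserved as the initial state; hence `1 + j`. -/
theorem encodeWords_tokenTransition {n m : ℕ} (j : Fin m) (t : Option (Fin n × Bool)) :
    encodeWords [unary (tokenTransition j t).1, eventWord (tokenTransition j t).2.1,
      unary (tokenTransition j t).2.2] = (toToken t).moveCode (1 + j) := by
  rcases t with _ | ⟨i, s⟩
  · simp [encodeWords_cons, map_some_unary, tokenTransition, eventWord, toToken, Token.moveCode,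
      add_comm 1]
  · have : marks true (2 * i + s.toNat) = marks true s.toNat ++ marks true (2 * i) := by
      rw [← marks_add, add_comm]
    simp [encodeWords_cons, map_some_unary, tokenTransition, eventWord, toToken, Token.moveCode,
      literalEvent, this, add_comm 1]

theorem encode_clauseInstance (n : ℕ) (cs : List (List (Fin n × Bool))) :
    (clauseInstance n cs).encode = outputCode n ((tokens cs).map toToken) := by
  rw [Instance.encode, Instance.words, encodeWords_append, encodeWords_append, encodeWords_append,
    encodeWords_flatMap, encodeWords_flatMap, encodeWords_flatMap, outputCode]
  have h₁ : encodeWords [unary (clauseInstance n cs).numStates, unary (clauseInstance n cs).numProt,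
      unary (clauseInstance n cs).numUnprot, binary (clauseInstance n cs).budget] =
      (marks true (((tokens cs).map toToken).length + 2) ++ [none]) ++
        (marks true (2 * n) ++ [none, some true, none] ++ (marks true n ++ [none])) := by
    simp [clauseInstance, encodeWords_cons, map_some_unary, binary_two_pow_sub_one]
  have h₂ : ((List.finRange (clauseInstance n cs).numStates).flatMap fun q =>
      encodeWords [[(clauseInstance n cs).isInitial q, (clauseInstance n cs).isSecret q],
        binary ((clauseInstance n cs).level q)]) =
      [some true, some false, none, some true, none] ++
        ((tokens cs).map toToken).flatMap Token.stateCode ++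
        [some false, some false, none, some true, none] := by
    rw [List.append_assoc]
    refine (flatMap_finRange_succ (m := (tokens cs).length + 1) _).trans
      (congrArg₂ (· ++ ·) (by simp [clauseInstance, encodeWords_cons, binary]) ?_)
    -- The state after the last token corresponds to a failed lookup and is not secret.
    refine (flatMap_finRange_getElem? (tokens cs) fun t =>
      encodeWords [[false, t.any Option.isNone], binary 1]).trans ?_
    have h : binary 1 = [true] := binary_two_pow 0
    rw [List.flatMap_map, h]
    refine congrArg₂ (· ++ ·) (congrArg (fun f => List.flatMap f (tokens cs)) ?_) rfl
    funext t
    cases t <;> rfl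
  have h₃ : ((List.finRange (clauseInstance n cs).numProt).flatMap fun a =>
      encodeWords [binary ((clauseInstance n cs).clearance a),
        binary ((clauseInstance n cs).cost a).num, binary ((clauseInstance n cs).cost a).den]) =
      eventCode n := by
    rw [eventCode_eq, ← List.map_coe_finRange_eq_range, List.flatMap_map]
    change (List.finRange (2 * n)).flatMap (fun a : Fin (2 * n) => encodeWords [binary 1,
      binary ((2 : ℚ≥0) ^ (n - 1 - (a : ℕ) / 2)).num,
      binary ((2 : ℚ≥0) ^ (n - 1 - (a : ℕ) / 2)).den]) = _
    refine congrArg (fun f => List.flatMap f (List.finRange (2 * n))) (funext fun a => ?_)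
    have h : binary 1 = [true] := binary_two_pow 0
    have hnum : ((2 : ℚ≥0) ^ (n - 1 - (a : ℕ) / 2)).num = 2 ^ (n - 1 - (a : ℕ) / 2) := by
      rw [NNRat.num_pow]; rfl
    have hden : ((2 : ℚ≥0) ^ (n - 1 - (a : ℕ) / 2)).den = 1 := by
      rw [NNRat.den_pow, show (2 : ℚ≥0).den = 1 from rfl, one_pow]
    rw [hnum, hden, binary_two_pow, h]
    simp [encodeWords_cons, marks]
  have h₄ : ((clauseInstance n cs).transitions.flatMap fun t =>
      encodeWords [unary t.1, eventWord t.2.1, unary t.2.2]) =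
      [none, some false, none, some true, none] ++
        moveCodes 1 ((tokens cs).map toToken) := by
    refine List.flatMap_cons.trans (congrArg₂ (· ++ ·) rfl ?_)
    rw [← flatMap_ofFn_moveCode]
    refine (List.flatMap_def ..).trans (congrArg List.flatten ?_)
    refine (List.map_ofFn ..).trans ?_
    refine List.ext_getElem (by simp) fun j hj hj' => ?_
    rw [List.getElem_ofFn, List.getElem_ofFn]
    refine (encodeWords_tokenTransition ..).trans ?_
    simp
  exact congrArg₂ (· ++ ·) (congrArg₂ (· ++ ·) (congrArg₂ (· ++ ·) h₁ h₂) h₃) h₄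

/-! ### Size and running time of the reduction -/

theorem length_eventCode_le (n : ℕ) : (eventCode n).length ≤ n * (2 * n + 12) := by
  induction n with
  | zero => simp [eventCode]
  | succ n ih =>
    simp only [eventCode, List.length_append, List.length_cons, List.length_nil, length_marks]
    nlinarith

theorem length_moveCode_le (t : Token) (j N : ℕ) (ht : ∀ l ∈ t, l.1 ≤ N) :
    (t.moveCode j).length ≤ 2 * j + 2 * N + 6 := by
  rcases t with _ | ⟨i, s⟩
  · simp [Token.moveCode]
    omega
  · have : i ≤ N := ht (i, s) rfl
    have := s.toNat_le
    simp [Token.moveCode]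
    omega

theorem length_moveCodes_le (T : List Token) (j N : ℕ) (hT : ∀ t ∈ T, ∀ l ∈ t, l.1 ≤ N) :
    (moveCodes j T).length ≤ T.length * (2 * (j + T.length) + 2 * N + 6) := by
  induction T generalizing j with
  | nil => simp [moveCodes]
  | cons t T ih =>
    have h₁ := length_moveCode_le t j N (hT t (by simp))
    have h₂ := ih (j + 1) fun t ht => hT t (by simp [ht])
    rw [moveCodes, List.length_append, List.length_cons]
    nlinarith

theorem length_outputCode_le (n : ℕ) (T : List Token) (hT : ∀ t ∈ T, ∀ l ∈ t, l.1 ≤ n) :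
    (outputCode n T).length ≤ n * (2 * n + 15) + T.length * (2 * T.length + 2 * n + 14) + 22 := by
  have h₁ := length_eventCode_le n
  have h₂ := length_moveCodes_le T 1 n hT
  have h₃ : (T.flatMap Token.stateCode).length = T.length * 5 := by
    simp [List.length_flatMap, Token.stateCode]
  simp only [outputCode, List.length_append, List.length_cons, List.length_nil, length_marks, h₃]
  nlinarith

theorem length_tokens {α : Type} (cs : List (List α)) (k : ℕ) (h : ∀ C ∈ cs, C.length ≤ k) :
    (tokens cs).length ≤ cs.length * (k + 1) := by
  induction cs with
  | nil => simp
  | cons C cs ih =>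
    have h₁ := h C (by simp)
    have h₂ := ih fun C hC => h C (by simp [hC])
    simp only [tokens_cons, List.length_append, List.length_map, List.length_cons]
    nlinarith

/-- There are only polynomially many clauses. -/
theorem CNF3.length_clauses_le (φ : CNF3) : φ.clauses.length ≤ (2 * φ.numVars + 1) ^ 3 := by
  -- A clause is determined by its entries at positions 0, 1, 2, each one of 2n literals or missing.
  let code : List (Fin φ.numVars × Bool) → Fin 3 → Option (Fin φ.numVars × Bool) :=
    fun C i => C[i.1]?
  have hinj : ∀ C ∈ φ.clauses, ∀ D ∈ φ.clauses, code C = code D → C = D := by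
    intro C hC D hD h
    refine List.ext_getElem? fun i => ?_
    by_cases hi : i < 3
    · exact congrFun h ⟨i, hi⟩
    · have h₁ := φ.length_le C hC
      have h₂ := φ.length_le D hD
      rw [List.getElem?_eq_none (by omega), List.getElem?_eq_none (by omega)]
  have := ((List.nodup_map_iff_inj_on φ.nodup).2 hinj).length_le_card
  simpa [mul_comm] using this

/-- The tokens on which the reduction machine works. -/
def CNF3.allTokens (φ : CNF3) : List Token :=
  (tokens (tautologies φ.numVars ++ φ.clauses)).map toToken

theorem CNF3.allTokens_le (φ : CNF3) : ∀ t ∈ φ.allTokens, ∀ l ∈ t, l.1 ≤ φ.numVars := by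
  intro t ht l hl
  obtain ⟨t, -, rfl⟩ := List.mem_map.1 ht
  obtain ⟨l, -, rfl⟩ := Option.map_eq_some_iff.1 hl
  exact l.1.2.le

/-- At most four tokens per clause, n tautologies and at most (2n+1)³ clauses: 36 = 4 · (1 + 8). -/
theorem CNF3.length_allTokens_le (φ : CNF3) :
    φ.allTokens.length ≤ 36 * (φ.numVars + 1) ^ 3 := by
  have h := length_tokens (tautologies φ.numVars ++ φ.clauses) 3 (by
    intro C hC
    rcases List.mem_append.1 hC with hC | hC
    · obtain ⟨i, -, rfl⟩ := List.mem_map.1 hC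
      simp
    · exact φ.length_le C hC)
  have h' := φ.length_clauses_le
  rw [List.length_append] at h
  simp only [tautologies, List.length_map, List.length_finRange] at h
  rw [CNF3.allTokens, List.length_map, tautologies]
  refine h.trans ?_
  calc (φ.numVars + φ.clauses.length) * (3 + 1)
      ≤ (φ.numVars + (2 * φ.numVars + 1) ^ 3) * (3 + 1) := by gcongr
    _ ≤ 36 * (φ.numVars + 1) ^ 3 := by ring_nf; nlinarith

/-- The left side dominates both the length of the output (with one to spare) and the steps spent
before it is collected; the total time bound is therefore twice the right side. -/
theorem poly_bound {n m : ℕ} (hm : m ≤ 36 * (n + 1) ^ 3) :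
    n * (2 * n + 15) + m * (2 * m + 2 * n + 17) + 40 ≤ 10000 * (n + 1) ^ 6 := by
  have h₁ : n + 1 ≤ (n + 1) ^ 3 := Nat.le_self_pow (by norm_num) _
  have h₂ : (n + 1) ^ 6 = (n + 1) ^ 3 * (n + 1) ^ 3 := by ring
  rw [h₂]
  generalize (n + 1) ^ 3 = c at *
  have h₃ : n ≤ c := by omega
  have h₄ : 1 ≤ c := by omega
  calc n * (2 * n + 15) + m * (2 * m + 2 * n + 17) + 40
      ≤ c * (2 * c + 15 * c) + (36 * c) * (2 * (36 * c) + 2 * c + 17 * c) + 40 * (c * c) := by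
        gcongr <;> nlinarith
    _ ≤ 10000 * (c * c) := by nlinarith

theorem CNF3.encode_toInstance (φ : CNF3) :
    φ.toInstance.encode = outputCode φ.numVars φ.allTokens :=
  encode_clauseInstance ..

theorem CNF3.length_encode_toInstance_le (φ : CNF3) :
    φ.toInstance.encode.length + 1 ≤ 10000 * (φ.numVars + 1) ^ 6 := by
  have h := length_outputCode_le _ _ φ.allTokens_le
  have h' := poly_bound φ.length_allTokens_le
  rw [φ.encode_toInstance]
  nlinarith

/-- The reduction machine turns a formula into its instance in polynomial time. -/
theorem reductionMachine_outputs_toInstance (φ : CNF3) :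
    Nonempty (TM2OutputsInTime reductionMachine φ.encode (some φ.toInstance.encode)
      (20000 * (φ.numVars + 1) ^ 6)) := by
  obtain ⟨h⟩ := reductionMachine_outputs φ.numVars
    (((tokens φ.clauses).map toToken).flatMap Token.code) φ.allTokens φ.allTokens_le (by
      rw [tautologyCode_eq, CNF3.allTokens, tokens_append, List.map_append, List.flatMap_append])
  rw [← encode_eq, ← φ.encode_toInstance] at h
  refine ⟨⟨h.toEvalsTo, h.steps_le_m.trans ?_⟩⟩
  have h₁ := φ.length_encode_toInstance_le
  have h₂ := poly_bound φ.length_allTokens_le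
  nlinarith

/-! ### The lower bound -/

open Filter Asymptotics

theorem exists_pow_le_mul_two_rpow (d : ℕ) {δ : ℝ} (hδ : 0 < δ) :
    ∃ C : ℝ, 0 ≤ C ∧ ∀ n : ℕ, ((n : ℝ) + 1) ^ d ≤ C * 2 ^ (δ * n) := by
  have hr : (1 : ℝ) < 2 ^ δ := Real.one_lt_rpow (by norm_num) hδ
  have h := (isLittleO_pow_const_const_pow_of_one_lt (R := ℝ) d hr).isBigO
  -- The exponential never vanishes, so the asymptotic bound holds for all n after enlarging the
  -- constant.
  obtain ⟨C, hC⟩ := (isBigO_nat_atTop_iff fun n hn => by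
    exact absurd hn (by positivity)).1 h
  have hC0 : 0 ≤ C := by
    have := hC 0
    by_contra hneg
    have h0 : 0 ≤ ‖((0 : ℕ) : ℝ) ^ d‖ := norm_nonneg _
    simp only [pow_zero, norm_one, mul_one] at this
    linarith
  refine ⟨C * 2 ^ δ, by positivity, fun n => ?_⟩
  have := hC (n + 1)
  rw [Real.norm_of_nonneg (by positivity), Real.norm_of_nonneg (by positivity)] at this
  push_cast at this
  rw [Real.rpow_mul (by norm_num), Real.rpow_natCast]
  calc _ ≤ _ := this
    _ = _ := by ring

/-- The finitely many N before the asymptotic bound takes effect are absorbed into D. -/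
theorem exists_le_mul_add {f : ℕ → ℝ} (hf : f =o[atTop] fun N : ℕ => (N : ℝ)) {δ : ℝ}
    (hδ : 0 < δ) : ∃ D : ℝ, ∀ N : ℕ, f N ≤ δ * N + D := by
  obtain ⟨N₀, hN₀⟩ := eventually_atTop.1 (hf.def hδ)
  refine ⟨∑ i ∈ Finset.range N₀, |f i|, fun N => ?_⟩
  have hnn : 0 ≤ ∑ i ∈ Finset.range N₀, |f i| := Finset.sum_nonneg fun _ _ => abs_nonneg _
  rcases le_or_gt N₀ N with h | h
  · have := hN₀ N h
    rw [Real.norm_eq_abs, Real.norm_of_nonneg (by positivity)] at this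
    linarith [le_abs_self (f N)]
  · have := Finset.single_le_sum (f := fun i => |f i|) (fun _ _ => abs_nonneg _)
      (Finset.mem_range.2 h)
    have h₂ : 0 ≤ δ * N := by positivity
    linarith [le_abs_self (f N)]

/-- A subexponential algorithm for a problem that contains the instances of all formulas
contradicts the exponential time hypothesis. -/
theorem not_solvableInSubexpTime (eth : ETH) (P : DecisionProblem) (r : CNF3 → P.Inst)
    (hencode : ∀ φ, P.encode (r φ) = φ.toInstance.encode)
    (hparam : ∀ φ, P.param (r φ) = 2 * φ.numVars) (hyes : ∀ φ, P.yes (r φ) ↔ φ.Satisfiable) :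
    ¬ P.SolvableInSubexpTime := by
  rintro ⟨f, hf, k, M, hM⟩
  obtain ⟨ε, hε, hETH⟩ := eth
  -- At N = 2n the slope ε/4 gives the exponent εn/2; the other εn/2 pays for the polynomial factor
  -- in the input length.
  obtain ⟨D, hD⟩ := exists_le_mul_add hf (show 0 < ε / 4 by positivity)
  obtain ⟨C₁, hC₁, h₁⟩ := exists_pow_le_mul_two_rpow 6 hε
  obtain ⟨C₂, hC₂, h₂⟩ := exists_pow_le_mul_two_rpow (6 * k) (show 0 < ε / 2 by positivity)
  -- The summand 40000 is 20000 for the reduction and 2 · 10000 for moving its output twice.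
  refine hETH ⟨40000 * C₁ + 2 ^ D * 10000 ^ k * C₂, ?_⟩
  refine ⟨⟨composeMachine reductionMachine M.tm (Equiv.refl (Option Bool)) M.inputAlphabet,
    Equiv.refl (Option Bool), M.outputAlphabet⟩, fun (φ : CNF3) => ?_⟩
  obtain ⟨answer, hanswer, t, ht, ⟨hout⟩⟩ := hM (r φ)
  simp only [hencode, hparam] at ht
  rw [hencode] at hout
  obtain ⟨hred⟩ := reductionMachine_outputs_toInstance φ
  -- The composition lemma expects the intermediate word translated by the alphabet equivalence,
  -- which is the identity here.
  rw [← List.map_id φ.toInstance.encode] at hred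
  have hlen := φ.length_encode_toInstance_le
  refine ⟨answer, hanswer.trans (hyes φ),
    20000 * (φ.numVars + 1) ^ 6 + t + 2 * (φ.toInstance.encode.length + 1), ?_, ?_⟩
  rotate_left
  · obtain ⟨hcomp⟩ := outputs_composeMachine (A := reductionMachine) (M := M.tm)
      (Equiv.refl (Option Bool)) M.inputAlphabet hred hout
    have e : φ.encode.map (Equiv.refl (Option Bool)).invFun = φ.encode := List.map_id _
    rw [← e] at hcomp
    exact ⟨hcomp⟩
  · change _ ≤ _ * (2 : ℝ) ^ (ε * (φ.numVars : ℝ))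
    set n := φ.numVars with hn
    set L := φ.toInstance.encode.length with hL
    have hlen' : (L : ℝ) + 1 ≤ 10000 * ((n : ℝ) + 1) ^ 6 := by exact_mod_cast hlen
    have ht' : (t : ℝ) ≤ 2 ^ D * 10000 ^ k * C₂ * 2 ^ (ε * n) := by
      have hf' : f (2 * n) ≤ ε / 2 * n + D := by
        have := hD (2 * n)
        push_cast at this
        linarith
      calc (t : ℝ) ≤ 2 ^ f (2 * n) * ((L : ℝ) + 1) ^ k := ht
        _ ≤ 2 ^ (ε / 2 * n + D) * (10000 * ((n : ℝ) + 1) ^ 6) ^ k := by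
          gcongr
          norm_num
        _ = 2 ^ D * 10000 ^ k * 2 ^ (ε / 2 * n) * ((n : ℝ) + 1) ^ (6 * k) := by
          rw [Real.rpow_add (by norm_num), mul_pow, ← pow_mul]
          ring
        _ ≤ 2 ^ D * 10000 ^ k * 2 ^ (ε / 2 * n) * (C₂ * 2 ^ (ε / 2 * n)) := by
          gcongr
          exact h₂ n
        _ = 2 ^ D * 10000 ^ k * C₂ * (2 ^ (ε / 2 * n) * 2 ^ (ε / 2 * n)) := by ring
        _ = 2 ^ D * 10000 ^ k * C₂ * 2 ^ (ε * n) := by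
          rw [← Real.rpow_add (by norm_num)]
          congr 2
          ring
    have h₁' := h₁ n
    push_cast
    nlinarith

end SecretProtection

theorem theorem3 (eth : SecretProtection.ETH) :
    ¬ SecretProtection.bcChiSPPU.SolvableInSubexpTime ∧
    ¬ SecretProtection.bcChiSPP.SolvableInSubexpTime ∧
    ¬ SecretProtection.bcSPPU.SolvableInSubexpTime ∧
    ¬ SecretProtection.bcSPP.SolvableInSubexpTime := by
  open SecretProtection in
  exact
    ⟨not_solvableInSubexpTime eth bcChiSPPU (fun φ => ⟨φ.toInstance, φ.toInstance_uniform⟩)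
        (fun _ => rfl) (fun _ => rfl) CNF3.hasChiValidPolicy_toInstance,
      not_solvableInSubexpTime eth bcChiSPP CNF3.toInstance (fun _ => rfl) (fun _ => rfl)
        CNF3.hasChiValidPolicy_toInstance,
      not_solvableInSubexpTime eth bcSPPU (fun φ => ⟨φ.toInstance, φ.toInstance_uniform⟩)
        (fun _ => rfl) (fun _ => rfl) CNF3.hasValidPolicy_toInstance,
      not_solvableInSubexpTime eth bcSPP CNF3.toInstance (fun _ => rfl) (fun _ => rfl)
        CNF3.hasValidPolicy_toInstance⟩
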